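/- Let $\rho>0$ and $0\le D\le p\le 1/2$. Bob draws a binary word $x$ of length $m$ with i.i.d. Bernoulli$(p)$ bits. Alice chooses a set $A$ of types (the type of a word is its fraction $N(x|1)/m$ of ones) that she skips, where $\Pr(N(x|1)/m\in A)\le 2^{-\alpha m}$ for a given $\alpha\in[0,\infty]$ (with $2^{-\infty\cdot m}=0$) and $\Pr(N(x|1)/m\in A)<1$, and a sequence of words which she guesses one after the other, such that every word whose type is not in $A$ is within Hamming distance $mD$ of some guess. For $x$ with type not in $A$, the guesswork $G(x)$ is the index, counted from $1$, of the first guess within Hamming distance $mD$ of $x$. Let $E(G^{*}(X;D,\alpha)^{\rho})$ denote the infimum, over all such choices of Alice, of the conditional expectation of $G(x)^{\rho}$ given that the type of $x$ is not in $A$. Put $$H(x)=-x\log_2x-(1-x)\log_2(1-x),\qquad D(s\|p)=s\log_2\frac sp+(1-s)\log_2\frac{1-s}{1-p},$$ $$H_{\frac1{1+\rho}}(p)=\frac{1+\rho}{\rho}\log_2\Big(p^{\frac1{1+\rho}}+(1-p)^{\frac1{1+\rho}}\Big),\qquad s^{*}=\frac{p^{\frac{1}{1+\rho}}}{p^{\frac{1}{1+\rho}}+(1-p)^{\frac{1}{1+\rho}}},$$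 with $0\log_2 0=0$ and $D(s\|0)=\infty$ for $s>0$. Then, for $\alpha=D(s\|p)$, the limit below exists and $$\lim_{m\to\infty}\frac1m\log_2E\big(G^{*}(X;D,\alpha)^{\rho}\big)\le\begin{cases}\rho\,\big(H_{\frac1{1+\rho}}(p)-H(D)\big), & s^{*}\le s\le 1,\\ \rho\,\big(H(s)-H(D)\big)-D(s\|p), & p<s\le s^{*}.\end{cases}$$ When the failure probability is zero ($\alpha=\infty$), $$\lim_{m\to\infty}\frac1m\log_2E\big(G^{*}(X;D,\infty)^{\rho}\big)=\rho\,\big(H_{\frac1{1+\rho}}(p)-H(D)\big).$$ -/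

import Mathlib

open Filter Topology
open scoped ENNReal

noncomputable section

namespace Guesswork

/-- The binary Shannon entropy in bits, `H(x) = -x log₂ x - (1 - x) log₂ (1 - x)`. -/
def entropy (x : ℝ) : ℝ := Real.binEntropy x / Real.log 2

/-- The Rényi entropy in bits, of order `a ≠ 1`, of a Bernoulli(`p`) bit. -/
def renyiEntropy (a p : ℝ) : ℝ := 1 / (1 - a) * Real.logb 2 (p ^ a + (1 - p) ^ a)

/-- The Kullback-Leibler divergence in bits `D(s‖p)` between Bernoulli(`s`) and Bernoulli(`p`),
as a real number (the right value whenever it is finite). -/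
def binKL (s p : ℝ) : ℝ :=
  s * Real.logb 2 (s / p) + (1 - s) * Real.logb 2 ((1 - s) / (1 - p))

open Classical in
/-- The same divergence with its value `∞` where Bernoulli(`s`) is not absolutely continuous
with respect to Bernoulli(`p`). Elsewhere `binKL s p ≥ 0`, so nothing is truncated. -/
def binKLExt (s p : ℝ) : ℝ≥0∞ :=
  if (p = 0 ∧ s ≠ 0) ∨ (p = 1 ∧ s ≠ 1) then ⊤ else ENNReal.ofReal (binKL s p)

/-- The point `s* = p^(1/(1+ρ)) / (p^(1/(1+ρ)) + (1-p)^(1/(1+ρ)))`. -/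
def sStar (ρ p : ℝ) : ℝ :=
  p ^ (1 / (1 + ρ)) / (p ^ (1 / (1 + ρ)) + (1 - p) ^ (1 / (1 + ρ)))

/-- The probability of the word `x` when its `m` bits are i.i.d. Bernoulli(`p`). -/
def wordProb (p : ℝ) {m : ℕ} (x : Fin m → Bool) : ℝ :=
  ∏ i, if x i = true then p else 1 - p

/-- The number `N(x|1)` of ones of the word `x`. -/
def numOnes {m : ℕ} (x : Fin m → Bool) : ℕ :=
  (Finset.univ.filter fun i => x i = true).card

/-- The type `N(x|1) / m` of the word `x`. -/
def wordType {m : ℕ} (x : Fin m → Bool) : ℝ := (numOnes x : ℝ) / (m : ℝ)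

/-- The guess `y` ends the game for the word `x`: their Hamming distance is at most `m * D`. -/
def Hits (D : ℝ) {m : ℕ} (x y : Fin m → Bool) : Prop :=
  (hammingDist x y : ℝ) ≤ (m : ℝ) * D

/-- The number of guesses needed for `x` when the words `g 0, g 1, g 2, …` are guessed in this
order. It is used only for words that are hit by some guess. -/
def guesswork (D : ℝ) {m : ℕ} (g : ℕ → Fin m → Bool) (x : Fin m → Bool) : ℕ :=
  sInf {k : ℕ | Hits D x (g k)} + 1

open Classical in
/-- The probability that the type of the word lies in the set `A` of skipped types. -/
def failureProb (p : ℝ) (m : ℕ) (A : Finset ℝ) : ℝ :=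
  ∑ x : Fin m → Bool, if wordType x ∈ A then wordProb p x else 0

/-- The allowed failure probability `2 ^ (-α m)`; it is zero for `α = ∞`. -/
def failureBound (α : ℝ≥0∞) (m : ℕ) : ℝ :=
  if α = ⊤ then 0 else (2 : ℝ) ^ (-(α.toReal * (m : ℝ)))

/-- An attack skips the words whose type is in `A`, and makes the guesses `g 0, g 1, …`, which
hit every word that is not skipped. It is admissible if the words that are skipped have total
probability at most `2 ^ (-α m)` (and not everything is skipped). -/
structure Admissible (p D : ℝ) (α : ℝ≥0∞) {m : ℕ} (A : Finset ℝ) (g : ℕ → Fin m → Bool) :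
    Prop where
  failure_le : failureProb p m A ≤ failureBound α m
  failure_lt_one : failureProb p m A < 1
  hits : ∀ x : Fin m → Bool, wordType x ∉ A → ∃ k, Hits D x (g k)

open Classical in
/-- The `ρ`-th moment of the guesswork of an attack, given that the word is not skipped. -/
def moment (p D ρ : ℝ) {m : ℕ} (A : Finset ℝ) (g : ℕ → Fin m → Bool) : ℝ :=
  (∑ x : Fin m → Bool,
    if wordType x ∈ A then 0 else wordProb p x * (guesswork D g x : ℝ) ^ ρ) /
      (1 - failureProb p m A)

/-- The `ρ`-th moment of the optimal guesswork: the infimum over all admissible attacks. -/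
def optMoment (p D ρ : ℝ) (α : ℝ≥0∞) (m : ℕ) : ℝ :=
  sInf {e : ℝ | ∃ (A : Finset ℝ) (g : ℕ → Fin m → Bool),
    Admissible p D α A g ∧ e = moment p D ρ A g}

/-- The normalized exponent `(1/m) log₂` of the `ρ`-th moment of the optimal guesswork. -/
def optRate (p D ρ : ℝ) (α : ℝ≥0∞) (m : ℕ) : ℝ :=
  1 / (m : ℝ) * Real.logb 2 (optMoment p D ρ α m)

end Guesswork

end

namespace Guesswork

/-! This is the method of types combined with a covering argument. The words of type about `q`
number `2^(m H(q))` up to a polynomial factor and have total probability about `2^(-m D(q‖p))`.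
Since `D ≤ 1/2`, a Hamming ball of radius `mD` has about `2^(m H(D))` words. Hence at least half of
an unskipped class needs about `2^(m (H(q) - H(D)))` guesses or more, and the class forces the rate
to be at least `ρ (H(q) - H(D)) - D(q‖p)` in the limit (`le_moment_of_not_mem`). A class with
`D(q‖p) < α` is too likely to be skipped (`eventually_lt_optRate`).

Conversely, greedy covering covers each weight class with that many balls, up to polynomial factors
and at least one ball (`exists_weight_cover`). Interleaving the `m + 1` covers gives one guessing
order that is good for all classes (`exists_universal_guess`). So only the maximal exponent among
the classes that are kept matters.

The maximum is read off from `exponent_eq`: `ρ H(q) - D(q‖p) = ρ H_{1/(1+ρ)}(p) - (1+ρ) D(q‖s*)`. It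
is attained at `s*`, and on `[p, s*]` the exponent is largest at the right end. If `s ≥ s*`,
skipping nothing is optimal to first order. If `s < s*`, skipping the types at least `s` leaves the
exponent at `s`. The bound `D ≤ p` gives `ρ H(D) ≤ ρ H(p)`, which is at most either exponent, so
classes covered by very few balls do not matter. A single tilting inequality, `prob_le_tilted`,
yields both the moment bound and, at `ρ = 0`, the Chernoff bound for the skipped types.

The limits obtained are equal to the stated bounds, except when `s = p = s* > 0`, where `α = 0` and
the limit is `0`. -/

/-! ### Binary divergence and entropy -/

/-- In this form nonnegativity, strictness, continuity and convexity are inherited from `klFun`,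
with no separate treatment of `s = 0` and `s = 1`. -/
theorem binKL_mul_log_two_eq_klFun {p : ℝ} (hp0 : 0 < p) (hp1 : p < 1) (s : ℝ) :
    binKL s p * Real.log 2 = p * InformationTheory.klFun (s / p) +
      (1 - p) * InformationTheory.klFun ((1 - s) / (1 - p)) := by
  have h1 : 1 - p ≠ 0 := by linarith
  have h2 : Real.log 2 ≠ 0 := (Real.log_pos one_lt_two).ne'
  unfold binKL InformationTheory.klFun Real.logb
  field_simp
  ring

theorem binKL_mul_log_two {p s : ℝ} (hp0 : 0 < p) (hp1 : p < 1) :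
    binKL s p * Real.log 2 = s * Real.log s + (1 - s) * Real.log (1 - s) -
      s * Real.log p - (1 - s) * Real.log (1 - p) := by
  have h2 : Real.log 2 ≠ 0 := (Real.log_pos one_lt_two).ne'
  have key : ∀ x y : ℝ, 0 < y → x * Real.log (x / y) = x * Real.log x - x * Real.log y := by
    intro x y hy
    rcases eq_or_ne x 0 with rfl | hx
    · simp
    · rw [Real.log_div hx hy.ne']; ring
  have e : binKL s p * Real.log 2 =
      s * Real.log (s / p) + (1 - s) * Real.log ((1 - s) / (1 - p)) := by
    unfold binKL Real.logb
    field_simp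
  rw [e, key s p hp0, key (1 - s) (1 - p) (by linarith)]
  ring

theorem entropy_mul_log_two (s : ℝ) :
    entropy s * Real.log 2 = -(s * Real.log s) - (1 - s) * Real.log (1 - s) := by
  have h2 : Real.log 2 ≠ 0 := (Real.log_pos one_lt_two).ne'
  unfold entropy Real.binEntropy
  rw [div_mul_cancel₀ _ h2, Real.log_inv, Real.log_inv]
  ring

theorem binKL_self {p : ℝ} (hp0 : 0 < p) (hp1 : p < 1) : binKL p p = 0 := by
  have h1 : 1 - p ≠ 0 := by linarith
  simp [binKL, div_self hp0.ne', div_self h1]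

theorem binKL_nonneg {p s : ℝ} (hp0 : 0 < p) (hp1 : p < 1) (hs0 : 0 ≤ s) (hs1 : s ≤ 1) :
    0 ≤ binKL s p := by
  have h := binKL_mul_log_two_eq_klFun hp0 hp1 s
  have a := InformationTheory.klFun_nonneg (div_nonneg hs0 hp0.le)
  have b := InformationTheory.klFun_nonneg
    (div_nonneg (sub_nonneg.2 hs1) (sub_nonneg.2 hp1.le))
  have c : 0 < 1 - p := by linarith
  have l := Real.log_pos one_lt_two
  have : 0 ≤ binKL s p * Real.log 2 := by rw [h]; positivity
  exact nonneg_of_mul_nonneg_left this l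

theorem binKL_pos {p s : ℝ} (hp0 : 0 < p) (hp1 : p < 1) (hs0 : 0 ≤ s) (hs1 : s ≤ 1)
    (hsp : s ≠ p) : 0 < binKL s p := by
  have h := binKL_mul_log_two_eq_klFun hp0 hp1 s
  have a := InformationTheory.klFun_nonneg (div_nonneg hs0 hp0.le)
  have b := InformationTheory.klFun_nonneg
    (div_nonneg (sub_nonneg.2 hs1) (sub_nonneg.2 hp1.le))
  have a' : InformationTheory.klFun (s / p) ≠ 0 := by
    rw [Ne, InformationTheory.klFun_eq_zero_iff (div_nonneg hs0 hp0.le),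
      div_eq_one_iff_eq hp0.ne']
    exact hsp
  have a'' := lt_of_le_of_ne a a'.symm
  have c : 0 < 1 - p := by linarith
  have l := Real.log_pos one_lt_two
  have : 0 < binKL s p * Real.log 2 := by rw [h]; positivity
  exact pos_of_mul_pos_left this l.le

theorem continuous_binKL_left {p : ℝ} (hp0 : 0 < p) (hp1 : p < 1) :
    Continuous fun s => binKL s p := by
  have l : Real.log 2 ≠ 0 := (Real.log_pos one_lt_two).ne'
  have e : (fun s => binKL s p) = fun s => (p * InformationTheory.klFun (s / p) +
      (1 - p) * InformationTheory.klFun ((1 - s) / (1 - p))) / Real.log 2 := by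
    funext s
    rw [eq_div_iff l, binKL_mul_log_two_eq_klFun hp0 hp1]
  rw [e]
  have := InformationTheory.continuous_klFun
  fun_prop

theorem continuous_entropy : Continuous entropy :=
  Real.binEntropy_continuous.div_const _

/-- Convexity of the divergence along the segment from `p` to `s`. -/
theorem binKL_segment_le {p s c : ℝ} (hp0 : 0 < p) (hp1 : p < 1) (hs0 : 0 ≤ s) (hs1 : s ≤ 1)
    (hc0 : 0 ≤ c) (hc1 : c ≤ 1) : binKL ((1 - c) * p + c * s) p ≤ c * binKL s p := by
  have l := Real.log_pos one_lt_two
  have c' : 0 < 1 - p := by linarith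
  have conv := InformationTheory.convexOn_klFun.2
  have a := conv (x := 1) (y := s / p) (by simp) (div_nonneg hs0 hp0.le)
    (sub_nonneg.2 hc1) hc0 (by ring)
  have b := conv (x := 1) (y := (1 - s) / (1 - p)) (by simp)
    (div_nonneg (sub_nonneg.2 hs1) c'.le) (sub_nonneg.2 hc1) hc0 (by ring)
  simp only [smul_eq_mul, InformationTheory.klFun_one, mul_zero, zero_add, mul_one] at a b
  have e1 : ((1 - c) * p + c * s) / p = 1 - c + c * (s / p) := by field_simp
  have e2 : (1 - ((1 - c) * p + c * s)) / (1 - p) = 1 - c + c * ((1 - s) / (1 - p)) := by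
    field_simp; ring
  refine le_of_mul_le_mul_right ?_ l
  rw [mul_assoc, binKL_mul_log_two_eq_klFun hp0 hp1, binKL_mul_log_two_eq_klFun hp0 hp1, e1, e2]
  nlinarith [mul_le_mul_of_nonneg_left a hp0.le, mul_le_mul_of_nonneg_left b c'.le]

/-- The point `q` lies on the segment from `p`, where the divergence vanishes, to `s`, with a
coefficient below `1`; convexity does the rest. -/
theorem binKL_lt_binKL {p q s : ℝ} (hp0 : 0 < p) (hp1 : p < 1) (hpq : p ≤ q) (hqs : q < s)
    (hs1 : s ≤ 1) : binKL q p < binKL s p := by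
  have hps : 0 < s - p := by linarith
  have hpos := binKL_pos hp0 hp1 (by linarith : 0 ≤ s) hs1 (by linarith)
  have h := binKL_segment_le (c := (q - p) / (s - p)) hp0 hp1 (by linarith : 0 ≤ s) hs1
    (div_nonneg (by linarith) hps.le) ((div_le_one hps).2 (by linarith))
  have e : (1 - (q - p) / (s - p)) * p + (q - p) / (s - p) * s = q := by
    field_simp; ring
  rw [e] at h
  have : (q - p) / (s - p) < 1 := (div_lt_one hps).2 (by linarith)
  nlinarith

theorem binKL_le_binKL_of_le {p s r : ℝ} (hp0 : 0 ≤ p) (hr1 : r < 1) (hps : p < s)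
    (hsr : s ≤ r) : binKL s r ≤ binKL p r := by
  have hr0 : 0 < r := by linarith
  have hpr : 0 < r - p := by linarith
  have hpos := binKL_nonneg hr0 hr1 hp0 (by linarith : p ≤ 1)
  have h1 : (r - s) / (r - p) ≤ 1 := (div_le_one hpr).2 (by linarith)
  have h := binKL_segment_le (c := (r - s) / (r - p)) hr0 hr1 hp0 (by linarith : p ≤ 1)
    (div_nonneg (by linarith) hpr.le) h1
  have e : (1 - (r - s) / (r - p)) * r + (r - s) / (r - p) * p = s := by
    field_simp; ring
  rw [e] at h
  nlinarith

/-! ### The tilted parameter and the exponent of a type -/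

section sStar

variable {ρ p : ℝ}

theorem sStar_den_pos (ρ : ℝ) (hp0 : 0 < p) (hp1 : p < 1) :
    0 < p ^ (1 / (1 + ρ)) + (1 - p) ^ (1 / (1 + ρ)) :=
  add_pos (Real.rpow_pos_of_pos hp0 _) (Real.rpow_pos_of_pos (by linarith) _)

theorem sStar_pos (ρ : ℝ) (hp0 : 0 < p) (hp1 : p < 1) : 0 < sStar ρ p :=
  div_pos (Real.rpow_pos_of_pos hp0 _) (sStar_den_pos ρ hp0 hp1)

theorem one_sub_sStar (ρ : ℝ) (hp0 : 0 < p) (hp1 : p < 1) : 1 - sStar ρ p =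
    (1 - p) ^ (1 / (1 + ρ)) / (p ^ (1 / (1 + ρ)) + (1 - p) ^ (1 / (1 + ρ))) := by
  have := (sStar_den_pos ρ hp0 hp1).ne'
  unfold sStar
  field_simp
  ring

theorem sStar_lt_one (ρ : ℝ) (hp0 : 0 < p) (hp1 : p < 1) : sStar ρ p < 1 := by
  have h := one_sub_sStar ρ hp0 hp1
  have : 0 < 1 - sStar ρ p := by
    rw [h]
    exact div_pos (Real.rpow_pos_of_pos (by linarith) _) (sStar_den_pos ρ hp0 hp1)
  linarith

theorem log_sStar (ρ : ℝ) (hp0 : 0 < p) (hp1 : p < 1) : Real.log (sStar ρ p) =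
    1 / (1 + ρ) * Real.log p - Real.log (p ^ (1 / (1 + ρ)) + (1 - p) ^ (1 / (1 + ρ))) := by
  unfold sStar
  rw [Real.log_div (Real.rpow_pos_of_pos hp0 _).ne' (sStar_den_pos ρ hp0 hp1).ne',
    Real.log_rpow hp0]

theorem log_one_sub_sStar (ρ : ℝ) (hp0 : 0 < p) (hp1 : p < 1) : Real.log (1 - sStar ρ p) =
    1 / (1 + ρ) * Real.log (1 - p) -
      Real.log (p ^ (1 / (1 + ρ)) + (1 - p) ^ (1 / (1 + ρ))) := by
  have h : 0 < 1 - p := by linarith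
  rw [one_sub_sStar ρ hp0 hp1, Real.log_div (Real.rpow_pos_of_pos h _).ne'
    (sStar_den_pos ρ hp0 hp1).ne', Real.log_rpow h]

/-- Cross-multiplied, the claim is `p (1-p)^a ≤ (1-p) p^a` with `a = 1/(1+ρ) ≤ 1`. Cancelling `p^a
(1-p)^a` leaves `p^(1-a) ≤ (1-p)^(1-a)`. -/
theorem le_sStar (hρ : 0 < ρ) (hp0 : 0 < p) (hp : p ≤ 1 / 2) : p ≤ sStar ρ p := by
  have h : 0 < 1 - p := by linarith
  rw [sStar, le_div_iff₀ (sStar_den_pos ρ hp0 (by linarith))]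
  set a := 1 / (1 + ρ) with ha
  have ha1 : a ≤ 1 := by rw [ha, div_le_one (by linarith)]; linarith
  have e1 : p = p ^ a * p ^ (1 - a) := by
    rw [← Real.rpow_add hp0]; simp
  have e2 : 1 - p = (1 - p) ^ a * (1 - p) ^ (1 - a) := by
    rw [← Real.rpow_add h]; simp
  have m : p ^ (1 - a) ≤ (1 - p) ^ (1 - a) :=
    Real.rpow_le_rpow hp0.le (by linarith) (by linarith)
  have k : p * (1 - p) ^ a ≤ (1 - p) * p ^ a := by
    calc p * (1 - p) ^ a = (p ^ a * p ^ (1 - a)) * (1 - p) ^ a := by rw [← e1]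
      _ = p ^ a * (1 - p) ^ a * p ^ (1 - a) := by ring
      _ ≤ p ^ a * (1 - p) ^ a * (1 - p) ^ (1 - a) := by gcongr
      _ = ((1 - p) ^ a * (1 - p) ^ (1 - a)) * p ^ a := by ring
      _ = (1 - p) * p ^ a := by rw [← e2]
  linarith

/-- The logarithms of `s*` and `1 - s*` are those of `p` and `1 - p` divided by `1 + ρ`, shifted by
the logarithm of a common normalizer. That normalizer is what the Rényi entropy measures, so the
maximization over `q` becomes the minimization of a divergence. -/
theorem exponent_eq (hρ : 0 < ρ) (hp0 : 0 < p) (hp1 : p < 1) (q : ℝ) :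
    ρ * entropy q - binKL q p =
      ρ * renyiEntropy (1 / (1 + ρ)) p - (1 + ρ) * binKL q (sStar ρ p) := by
  have l := (Real.log_pos one_lt_two).ne'
  have hρ' : 1 + ρ ≠ 0 := by linarith
  refine mul_right_cancel₀ l ?_
  have r : ρ * renyiEntropy (1 / (1 + ρ)) p * Real.log 2 =
      (1 + ρ) * Real.log (p ^ (1 / (1 + ρ)) + (1 - p) ^ (1 / (1 + ρ))) := by
    unfold renyiEntropy Real.logb
    have : 1 / (1 - 1 / (1 + ρ)) = (1 + ρ) / ρ := by
      have : 1 - 1 / (1 + ρ) = ρ / (1 + ρ) := by field_simp; ring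
      rw [this, one_div_div]
    rw [this]
    field_simp
  rw [sub_mul, sub_mul, r, mul_assoc, mul_assoc, binKL_mul_log_two hp0 hp1,
    binKL_mul_log_two (sStar_pos ρ hp0 hp1) (sStar_lt_one ρ hp0 hp1), entropy_mul_log_two,
    log_sStar ρ hp0 hp1, log_one_sub_sStar ρ hp0 hp1]
  field_simp
  ring

theorem exponent_sStar (hρ : 0 < ρ) (hp0 : 0 < p) (hp1 : p < 1) :
    ρ * entropy (sStar ρ p) - binKL (sStar ρ p) p = ρ * renyiEntropy (1 / (1 + ρ)) p := by
  rw [exponent_eq hρ hp0 hp1, binKL_self (sStar_pos ρ hp0 hp1) (sStar_lt_one ρ hp0 hp1)]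
  ring

theorem exponent_mono (hρ : 0 < ρ) (hp0 : 0 < p) (hp1 : p < 1) {s : ℝ} (hps : p ≤ s)
    (hs : s ≤ sStar ρ p) : ρ * entropy p ≤ ρ * entropy s - binKL s p := by
  rcases hps.eq_or_lt with rfl | hps
  · rw [binKL_self hp0 hp1]; linarith
  have h := exponent_eq hρ hp0 hp1 p
  rw [binKL_self hp0 hp1, sub_zero] at h
  rw [exponent_eq hρ hp0 hp1, h]
  have := binKL_le_binKL_of_le hp0.le (sStar_lt_one ρ hp0 hp1) hps hs
  nlinarith

/-- Comparison of a word probability with a tilted one. -/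
theorem prob_le_tilted (hp0 : 0 < p) (hp1 : p < 1) {s : ℝ} (hs0 : 0 < s)
    (hs1 : s < 1) {t m : ℕ} (htm : t ≤ m)
    (h : ((t : ℝ) - s * m) * (Real.log p - Real.log (1 - p) -
      (1 + ρ) * (Real.log s - Real.log (1 - s))) ≤ 0) :
    p ^ t * (1 - p) ^ (m - t) ≤ (2 : ℝ) ^ ((m : ℝ) * (ρ * entropy s - binKL s p)) *
      (s ^ t * (1 - s) ^ (m - t)) ^ (1 + ρ) := by
  have hp' : 0 < 1 - p := by linarith
  have hs' : 0 < 1 - s := by linarith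
  have a0 : 0 < p ^ t * (1 - p) ^ (m - t) := by positivity
  have b0 : 0 < s ^ t * (1 - s) ^ (m - t) := by positivity
  have c0 : (0 : ℝ) < (2 : ℝ) ^ ((m : ℝ) * (ρ * entropy s - binKL s p)) := by positivity
  rw [← Real.log_le_log_iff a0 (by positivity), Real.log_mul (by positivity) (by positivity),
    Real.log_mul c0.ne' (by positivity), Real.log_rpow two_pos, Real.log_rpow b0,
    Real.log_mul (by positivity) (by positivity), Real.log_pow, Real.log_pow, Real.log_pow,
    Real.log_pow, Nat.cast_sub htm]
  have e : (m : ℝ) * (ρ * entropy s - binKL s p) * Real.log 2 =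
      m * (ρ * (entropy s * Real.log 2) - binKL s p * Real.log 2) := by ring
  rw [e, entropy_mul_log_two, binKL_mul_log_two hp0 hp1]
  -- The left side minus the right side is exactly the product assumed nonpositive in `h`.
  linarith

end sStar

/-! ### Hypergeometric modes and the choice of centres -/

theorem le_of_unimodal {α : Type*} [Preorder α] {f : ℕ → α} {t d : ℕ}
    (hup : ∀ k, k + 1 ≤ t → f k ≤ f (k + 1))
    (hdown : ∀ k, t ≤ k → k + 1 ≤ d → f (k + 1) ≤ f k) {k : ℕ} (hk : k ≤ d) : f k ≤ f t := by
  rcases le_total k t with hkt | htk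
  · clear hk
    have : ∀ j, j ≤ t → f (t - j) ≤ f t := by
      intro j
      induction j with
      | zero => intro _; simp
      | succ j ih =>
        intro hj
        have h := hup (t - (j + 1)) (by omega)
        rw [show t - (j + 1) + 1 = t - j by omega] at h
        exact h.trans (ih (by omega))
    have h := this (t - k) (by omega)
    rwa [show t - (t - k) = k by omega] at h
  · induction k, htk using Nat.le_induction with
    | base => exact le_rfl
    | succ k hk' ih => exact (hdown k hk' hk).trans (ih (by omega))

/-- After subtracting `(a + 1) * (e + 1)`, the hypothesis says `(a+1)(n-e) ≤ (u-a)(e+1)`, which is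
the ratio test for consecutive hypergeometric terms. -/
theorem choose_mul_choose_succ_le {u a n e : ℕ} (h : (a + 1) * (n + 1) ≤ (u + 1) * (e + 1)) :
    u.choose a * n.choose (e + 1) ≤ u.choose (a + 1) * n.choose e := by
  rcases lt_or_ge u a with hua | hua
  · simp [Nat.choose_eq_zero_of_lt hua]
  rcases lt_or_ge n e with hne | hne
  · simp [Nat.choose_eq_zero_of_lt (Nat.lt_succ_of_lt hne)]
  have h1 := Nat.choose_succ_right_eq u a
  have h2 := Nat.choose_succ_right_eq n e
  obtain ⟨v, rfl⟩ := Nat.exists_eq_add_of_le hua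
  obtain ⟨w, rfl⟩ := Nat.exists_eq_add_of_le hne
  rw [Nat.add_sub_cancel_left] at h1 h2
  refine le_of_mul_le_mul_left (a := (a + 1) * (e + 1)) ?_ (by positivity)
  have k : (a + 1) * w ≤ v * (e + 1) := by nlinarith
  calc (a + 1) * (e + 1) * ((a + v).choose a * (e + w).choose (e + 1))
      = (a + 1) * (a + v).choose a * ((e + w).choose (e + 1) * (e + 1)) := by ring
    _ = (a + v).choose a * (e + w).choose e * ((a + 1) * w) := by rw [h2]; ring
    _ ≤ (a + v).choose a * (e + w).choose e * (v * (e + 1)) := Nat.mul_le_mul_left _ k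
    _ = (a + v).choose a * v * (e + w).choose e * (e + 1) := by ring
    _ = (a + 1) * (e + 1) * ((a + v).choose (a + 1) * (e + w).choose e) := by rw [← h1]; ring

/-- The mode of the hypergeometric distribution carries at least the average mass. -/
theorem choose_le_mul_mode {u n d : ℕ} (hd : d ≤ u + n) :
    (u + n).choose d ≤ (d + 1) * (u.choose ((u + 1) * (d + 1) / (u + n + 2)) *
      n.choose (d - (u + 1) * (d + 1) / (u + n + 2))) := by
  set t := (u + 1) * (d + 1) / (u + n + 2) with ht
  have htd : t ≤ d := by
    rw [ht, ← Nat.lt_succ_iff, Nat.div_lt_iff_lt_mul (by positivity)]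
    nlinarith
  have h1 : t * (u + n + 2) ≤ (u + 1) * (d + 1) := Nat.div_mul_le_self _ _
  have h2 : (u + 1) * (d + 1) < (t + 1) * (u + n + 2) := by
    rw [← Nat.div_lt_iff_lt_mul (by positivity)]; exact Nat.lt_succ_self _
  rw [Nat.add_choose_eq, Finset.Nat.sum_antidiagonal_eq_sum_range_succ_mk]
  have : ∀ k ∈ Finset.range (d + 1),
      u.choose k * n.choose (d - k) ≤ u.choose t * n.choose (d - t) := by
    intro k hk
    refine le_of_unimodal (f := fun k => u.choose k * n.choose (d - k)) ?_ ?_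
      (Nat.lt_succ_iff.1 (Finset.mem_range.1 hk))
    · intro k hkt
      obtain ⟨e, rfl⟩ := Nat.exists_eq_add_of_le (hkt.trans htd)
      simp only [show k + 1 + e - k = e + 1 by omega, show k + 1 + e - (k + 1) = e by omega]
      apply choose_mul_choose_succ_le
      have := Nat.mul_le_mul_right (u + n + 2) hkt
      nlinarith
    · intro k htk hkd
      obtain ⟨e, rfl⟩ := Nat.exists_eq_add_of_le hkd
      simp only [show k + 1 + e - k = e + 1 by omega, show k + 1 + e - (k + 1) = e by omega]
      rw [mul_comm, mul_comm (u.choose k)]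
      apply choose_mul_choose_succ_le
      have := Nat.mul_le_mul_right (u + n + 2) (Nat.succ_le_succ htk)
      simp only [Nat.succ_eq_add_one] at this
      nlinarith
  calc _ ≤ ∑ k ∈ Finset.range (d + 1), u.choose t * n.choose (d - t) := Finset.sum_le_sum this
    _ = _ := by simp

/-- Every weight `t` between `d` and `m - d` is the typical weight of a word at distance `d` from
a centre of some weight `u`; here `a` ones and `d - a` zeros of the centre are flipped. -/
theorem exists_centre_weight {m d t : ℕ} (hdt : d ≤ t) (htd : t + d ≤ m) :
    ∃ u a, u ≤ m ∧ a ≤ d ∧ u + d = t + 2 * a ∧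
      m.choose d ≤ (d + 1) * (u.choose a * (m - u).choose (d - a)) := by
  -- The mode from `choose_le_mul_mode` for a centre of weight `u`. Flipping `f u` ones and `d - f
  -- u` zeros leads to weight `u + d - 2 f u`, which has to be `t`.
  let f : ℕ → ℕ := fun u => (u + 1) * (d + 1) / (m + 2)
  have f0 : f 0 = 0 := Nat.div_eq_of_lt (by omega)
  have fm : f m = d := by
    refine Nat.div_eq_of_lt_le ?_ ?_ <;> nlinarith
  have step : ∀ u, f (u + 1) ≤ f u + 1 := by
    intro u
    have : f u + 1 = ((u + 1) * (d + 1) + (m + 2)) / (m + 2) :=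
      (Nat.add_div_right _ (by positivity)).symm
    rw [this]
    exact Nat.div_le_div_right (by nlinarith)
  have mono : ∀ u, f u ≤ f (u + 1) := fun u => Nat.div_le_div_right (by nlinarith)
  -- Discrete intermediate value argument: `u + d - 2 f u` starts at `d ≤ t`, rises by at most one
  -- per step because `f` is monotone, and ends at `m - d ≥ t`.
  have ivt : ∀ u, t + 2 * f u ≤ u + d → ∃ v ≤ u, v + d = t + 2 * f v := by
    intro u
    induction u with
    | zero => intro h; exact ⟨0, le_rfl, by omega⟩
    | succ u ih =>
      intro h
      rcases h.eq_or_lt with h | h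
      · exact ⟨u + 1, le_rfl, h.symm⟩
      · have := mono u
        obtain ⟨v, hv, e⟩ := ih (by omega)
        exact ⟨v, by omega, e⟩
  obtain ⟨u, hu, e⟩ := ivt m (by omega)
  have hmono : Monotone f := monotone_nat_of_le_succ mono
  refine ⟨u, f u, hu, (hmono hu).trans fm.le, e, ?_⟩
  have h := choose_le_mul_mode (u := u) (n := m - u) (d := d) (by omega)
  rwa [show u + (m - u) = m by omega] at h

/-- Both sides are the multinomial coefficient counting pairs of words with `w` common ones, `a` and
`b` ones in just one of them, and `c` common zeros. The symmetry converts neighbours per centre into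
centres per word. -/
theorem choose_mul_choose_mul_choose_comm (w a b c : ℕ) :
    (w + a + b + c).choose (w + b) * ((w + b).choose b * (a + c).choose a) =
      (w + a + b + c).choose (w + a) * ((w + a).choose a * (b + c).choose b) := by
  have key : ∀ a b : ℕ, (w + a + b + c).choose (w + b) * ((w + b).choose b * (a + c).choose a) *
      (w.factorial * a.factorial * b.factorial * c.factorial) = (w + a + b + c).factorial := by
    intro a b
    have h1 := Nat.choose_mul_factorial_mul_factorial (n := w + a + b + c) (k := w + b) (by omega)
    have h2 := Nat.choose_mul_factorial_mul_factorial (n := w + b) (k := b) (by omega)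
    have h3 := Nat.choose_mul_factorial_mul_factorial (n := a + c) (k := a) (by omega)
    rw [show w + a + b + c - (w + b) = a + c by omega] at h1
    rw [show w + b - b = w by omega] at h2
    rw [show a + c - a = c by omega] at h3
    rw [← h1, ← h2, ← h3]
    ring
  have p : 0 < w.factorial * a.factorial * b.factorial * c.factorial := by positivity
  refine Nat.eq_of_mul_eq_mul_right p ?_
  rw [key a b, show w + a + b + c = w + b + a + c by omega,
    show w.factorial * a.factorial * b.factorial * c.factorial =
      w.factorial * b.factorial * a.factorial * c.factorial by ring, key b a]

/-! ### Exponential growth of binomial coefficients -/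

/-- The binomial distribution with `m` trials and mean `t` gives mass at least `1 / (m + 1)` to
its mean. -/
theorem pow_le_mul_choose_mul_pow {m t : ℕ} (htm : t ≤ m) :
    m ^ m ≤ (m + 1) * (m.choose t * (t ^ t * (m - t) ^ (m - t))) := by
  have e := add_pow t (m - t) m
  rw [Nat.add_sub_cancel' htm] at e
  have : ∀ k ∈ Finset.range (m + 1), t ^ k * (m - t) ^ (m - k) * m.choose k ≤
      m.choose t * (t ^ t * (m - t) ^ (m - t)) := by
    intro k hk
    have h := le_of_unimodal (t := t) (f := fun k => t ^ k * (m - t) ^ (m - k) * m.choose k) ?_ ?_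
      (Nat.lt_succ_iff.1 (Finset.mem_range.1 hk))
    · exact h.trans (by rw [mul_comm])
    · intro k hkt
      obtain ⟨n, rfl⟩ := Nat.exists_eq_add_of_le (hkt.trans htm)
      simp only [show k + 1 + n - k = n + 1 by omega, show k + 1 + n - (k + 1) = n by omega]
      obtain ⟨r, hr⟩ := Nat.exists_eq_add_of_le htm
      rw [show k + 1 + n - t = r by omega]
      have c := Nat.choose_succ_right_eq (k + 1 + n) k
      rw [show k + 1 + n - k = n + 1 by omega] at c
      refine le_of_mul_le_mul_left (a := k + 1) ?_ (by positivity)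
      have q : (k + 1) * r ≤ t * (n + 1) := by
        have : r ≤ n + 1 := by omega
        exact Nat.mul_le_mul hkt this
      calc (k + 1) * (t ^ k * r ^ (n + 1) * (k + 1 + n).choose k)
          = t ^ k * r ^ n * (k + 1 + n).choose k * ((k + 1) * r) := by ring
        _ ≤ t ^ k * r ^ n * (k + 1 + n).choose k * (t * (n + 1)) := Nat.mul_le_mul_left _ q
        _ = t ^ (k + 1) * r ^ n * ((k + 1 + n).choose k * (n + 1)) := by ring
        _ = _ := by rw [← c]; ring
    · intro k htk hkm
      obtain ⟨n, rfl⟩ := Nat.exists_eq_add_of_le hkm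
      simp only [show k + 1 + n - k = n + 1 by omega, show k + 1 + n - (k + 1) = n by omega]
      obtain ⟨r, hr⟩ := Nat.exists_eq_add_of_le htm
      rw [show k + 1 + n - t = r by omega]
      have c := Nat.choose_succ_right_eq (k + 1 + n) k
      rw [show k + 1 + n - k = n + 1 by omega] at c
      refine le_of_mul_le_mul_left (a := k + 1) ?_ (by positivity)
      have q : t * (n + 1) ≤ (k + 1) * r := by
        have : n + 1 ≤ r := by omega
        exact Nat.mul_le_mul (by omega) this
      calc (k + 1) * (t ^ (k + 1) * r ^ n * (k + 1 + n).choose (k + 1))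
          = t ^ (k + 1) * r ^ n * ((k + 1 + n).choose (k + 1) * (k + 1)) := by ring
        _ = t ^ k * r ^ n * (k + 1 + n).choose k * (t * (n + 1)) := by rw [c]; ring
        _ ≤ t ^ k * r ^ n * (k + 1 + n).choose k * ((k + 1) * r) := Nat.mul_le_mul_left _ q
        _ = _ := by ring
  calc m ^ m = _ := e
    _ ≤ ∑ k ∈ Finset.range (m + 1), m.choose t * (t ^ t * (m - t) ^ (m - t)) :=
      Finset.sum_le_sum this
    _ = _ := by simp

theorem choose_mul_pow_le_pow {m t : ℕ} (htm : t ≤ m) :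
    m.choose t * (t ^ t * (m - t) ^ (m - t)) ≤ m ^ m := by
  have e := add_pow t (m - t) m
  rw [Nat.add_sub_cancel' htm] at e
  rw [e, mul_comm]
  exact Finset.single_le_sum (f := fun k => t ^ k * (m - t) ^ (m - k) * m.choose k)
    (fun _ _ => Nat.zero_le _) (Finset.mem_range.2 (Nat.lt_succ_of_le htm))

theorem log_pow_mul_pow_eq {m t : ℕ} (hm : 0 < m) (htm : t ≤ m) :
    Real.log ((m : ℝ) ^ m) - Real.log ((t : ℝ) ^ t * ((m - t : ℕ) : ℝ) ^ (m - t)) =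
      m * (entropy ((t : ℝ) / m) * Real.log 2) := by
  have hm' : (m : ℝ) ≠ 0 := by positivity
  have pos : ∀ k : ℕ, ((k : ℝ) ^ k) ≠ 0 := by
    intro k
    rcases eq_or_ne k 0 with rfl | h
    · simp
    · positivity
  have key : ∀ k : ℕ, (m : ℝ) * ((k / m : ℝ) * Real.log (k / m)) =
      k * Real.log k - k * Real.log m := by
    intro k
    rcases eq_or_ne k 0 with rfl | h
    · simp
    · rw [Real.log_div (by positivity) hm']; field_simp
  have e : 1 - (t : ℝ) / m = ((m - t : ℕ) : ℝ) / m := by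
    rw [Nat.cast_sub htm]; field_simp
  rw [entropy_mul_log_two, mul_sub, mul_neg, e, key, key, Real.log_mul (pos _) (pos _),
    Real.log_pow, Real.log_pow, Real.log_pow, Nat.cast_sub htm]
  ring

theorem logb_choose_le {m t : ℕ} (hm : 0 < m) (htm : t ≤ m) :
    Real.logb 2 (m.choose t) ≤ m * entropy ((t : ℝ) / m) := by
  have l := Real.log_pos one_lt_two
  have hc : (0 : ℝ) < m.choose t := by exact_mod_cast Nat.choose_pos htm
  have pos : ∀ k : ℕ, 0 < (k : ℝ) ^ k := by
    intro k
    rcases eq_or_ne k 0 with rfl | h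
    · simp
    · positivity
  have h : (m.choose t : ℝ) * ((t : ℝ) ^ t * ((m - t : ℕ) : ℝ) ^ (m - t)) ≤ (m : ℝ) ^ m := by
    exact_mod_cast choose_mul_pow_le_pow htm
  have h' := Real.log_le_log (mul_pos hc (mul_pos (pos _) (pos _))) h
  rw [Real.log_mul hc.ne' (mul_pos (pos _) (pos _)).ne'] at h'
  have e := log_pow_mul_pow_eq hm htm
  rw [Real.logb, div_le_iff₀ l]
  linarith

theorem le_logb_choose {m t : ℕ} (hm : 0 < m) (htm : t ≤ m) :
    m * entropy ((t : ℝ) / m) - Real.logb 2 (m + 1) ≤ Real.logb 2 (m.choose t) := by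
  have l := Real.log_pos one_lt_two
  have hc : (0 : ℝ) < m.choose t := by exact_mod_cast Nat.choose_pos htm
  have pos : ∀ k : ℕ, 0 < (k : ℝ) ^ k := by
    intro k
    rcases eq_or_ne k 0 with rfl | h
    · simp
    · positivity
  have h : (m : ℝ) ^ m ≤
      (m + 1) * ((m.choose t : ℝ) * ((t : ℝ) ^ t * ((m - t : ℕ) : ℝ) ^ (m - t))) := by
    exact_mod_cast pow_le_mul_choose_mul_pow htm
  have h' := Real.log_le_log (pos _) h
  have hm1 : (0 : ℝ) < m + 1 := by positivity
  rw [Real.log_mul hm1.ne' (mul_pos hc (mul_pos (pos _) (pos _))).ne',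
    Real.log_mul hc.ne' (mul_pos (pos _) (pos _)).ne'] at h'
  have e := log_pow_mul_pow_eq hm htm
  rw [Real.logb, Real.logb, le_div_iff₀ l, sub_mul, div_mul_cancel₀ _ l.ne']
  linarith

theorem tendsto_logb_succ_div :
    Tendsto (fun m : ℕ => 1 / (m : ℝ) * Real.logb 2 (m + 1)) atTop (𝓝 0) := by
  have h1 : Tendsto (fun m : ℕ => ((m + 1 : ℕ) : ℝ)) atTop atTop :=
    tendsto_natCast_atTop_atTop.comp (tendsto_add_atTop_nat 1)
  have h2 := (Real.isLittleO_log_id_atTop.tendsto_div_nhds_zero).comp h1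
  have h3 : Tendsto (fun m : ℕ => ((m : ℝ) + 1) / m) atTop (𝓝 1) := by
    have : Tendsto (fun m : ℕ => 1 + 1 / (m : ℝ)) atTop (𝓝 (1 + 0)) :=
      tendsto_const_nhds.add tendsto_one_div_atTop_nhds_zero_nat
    rw [add_zero] at this
    refine this.congr' ?_
    filter_upwards [eventually_gt_atTop 0] with m hm
    have : (m : ℝ) ≠ 0 := by positivity
    field_simp
  have h4 := (h2.mul h3).div_const (Real.log 2)
  rw [zero_mul, zero_div] at h4
  refine h4.congr ?_
  intro m
  have : (m : ℝ) + 1 ≠ 0 := by positivity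
  simp only [Function.comp, id, Real.logb]
  push_cast
  field_simp

theorem tendsto_logb_choose {t : ℕ → ℕ} {q : ℝ} (ht : ∀ m, t m ≤ m)
    (hq : Tendsto (fun m : ℕ => (t m : ℝ) / m) atTop (𝓝 q)) :
    Tendsto (fun m : ℕ => 1 / (m : ℝ) * Real.logb 2 (m.choose (t m))) atTop
      (𝓝 (entropy q)) := by
  have h1 : Tendsto (fun m : ℕ => entropy ((t m : ℝ) / m)) atTop (𝓝 (entropy q)) :=
    (continuous_entropy.tendsto q).comp hq
  have h2 := h1.sub tendsto_logb_succ_div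
  rw [sub_zero] at h2
  refine tendsto_of_tendsto_of_tendsto_of_le_of_le' h2 h1 ?_ ?_
  · filter_upwards [eventually_gt_atTop 0] with m hm
    have hm' : (0 : ℝ) < m := by exact_mod_cast hm
    have := mul_le_mul_of_nonneg_left (le_logb_choose hm (ht m)) (one_div_pos.2 hm').le
    refine le_trans (le_of_eq ?_) this
    field_simp
  · filter_upwards [eventually_gt_atTop 0] with m hm
    have hm' : (0 : ℝ) < m := by exact_mod_cast hm
    have := mul_le_mul_of_nonneg_left (logb_choose_le hm (ht m)) (one_div_pos.2 hm').le
    refine le_trans this (le_of_eq ?_)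
    field_simp

/-! ### Words, weight classes and Hamming balls -/

open Finset in
theorem numOnes_le {m : ℕ} (x : Fin m → Bool) : numOnes x ≤ m := by
  exact (card_filter_le (univ : Finset (Fin m)) fun i => x i = true).trans (by simp)

theorem wordProb_eq (p : ℝ) {m : ℕ} (x : Fin m → Bool) :
    wordProb p x = p ^ numOnes x * (1 - p) ^ (m - numOnes x) := by
  have h := Finset.card_filter_add_card_filter_not (s := (Finset.univ : Finset (Fin m)))
    (fun i => x i = true)
  rw [Finset.card_univ, Fintype.card_fin] at h
  rw [wordProb, Finset.prod_ite, Finset.prod_const, Finset.prod_const, numOnes]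
  congr 2
  omega

theorem card_numOnes_eq (m t : ℕ) :
    (Finset.univ.filter fun x : Fin m → Bool => numOnes x = t).card = m.choose t := by
  have e := Finset.card_powersetCard t (Finset.univ : Finset (Fin m))
  rw [Finset.card_univ, Fintype.card_fin] at e
  rw [← e]
  refine Finset.card_nbij' (fun x => Finset.univ.filter fun i => x i = true)
    (fun S i => decide (i ∈ S)) ?_ ?_ ?_ ?_
  · intro x hx
    exact Finset.mem_powersetCard.2 ⟨Finset.subset_univ _, (Finset.mem_filter.1 hx).2⟩
  · intro S hS
    refine Finset.mem_filter.2 ⟨Finset.mem_univ _, ?_⟩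
    rw [← (Finset.mem_powersetCard.1 hS).2, numOnes]
    congr 1
    ext i
    simp
  · intro x _
    funext i
    simp
  · intro S _
    ext i
    simp

theorem sum_apply_numOnes (m : ℕ) (f : ℕ → ℝ) :
    ∑ x : Fin m → Bool, f (numOnes x) = ∑ t ∈ Finset.range (m + 1), m.choose t * f t := by
  rw [← Finset.sum_fiberwise_of_maps_to (t := Finset.range (m + 1)) (g := numOnes)
    (fun x _ => Finset.mem_range.2 (Nat.lt_succ_of_le (numOnes_le x)))]
  refine Finset.sum_congr rfl fun t _ => ?_
  rw [Finset.sum_congr rfl fun x hx => by rw [(Finset.mem_filter.1 hx).2], Finset.sum_const,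
    card_numOnes_eq, nsmul_eq_mul]

theorem sum_binomial (p : ℝ) (m : ℕ) :
    ∑ t ∈ Finset.range (m + 1), (m.choose t : ℝ) * (p ^ t * (1 - p) ^ (m - t)) = 1 := by
  have := add_pow p (1 - p) m
  rw [add_sub_cancel, one_pow] at this
  refine Eq.trans ?_ this.symm
  exact Finset.sum_congr rfl fun t _ => by ring

theorem sum_wordProb (p : ℝ) (m : ℕ) : ∑ x : Fin m → Bool, wordProb p x = 1 := by
  simp_rw [wordProb_eq]
  rw [sum_apply_numOnes m fun t => p ^ t * (1 - p) ^ (m - t), sum_binomial]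

theorem wordProb_nonneg {p : ℝ} (hp0 : 0 ≤ p) (hp1 : p ≤ 1) {m : ℕ} (x : Fin m → Bool) :
    0 ≤ wordProb p x := by
  have : 0 ≤ 1 - p := by linarith
  rw [wordProb_eq]
  positivity

/-- Switching off `b` ones and switching on `a` zeros of `x` determines the two switched sets, so
distinct choices give distinct neighbours. -/
theorem choose_mul_choose_le_card_neighbours {m : ℕ} (x : Fin m → Bool) (a b : ℕ) :
    (numOnes x).choose b * (m - numOnes x).choose a ≤
      (Finset.univ.filter fun y : Fin m → Bool =>
        numOnes y + b = numOnes x + a ∧ hammingDist x y ≤ a + b).card := by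
  set S : Finset (Fin m) := Finset.univ.filter fun i => x i = true with hS
  have hSc : Sᶜ.card = m - numOnes x := by rw [Finset.card_compl, Fintype.card_fin]; rfl
  have hSn : S.card = numOnes x := rfl
  have mS : ∀ i, i ∈ S ↔ x i = true := fun i => by simp [hS]
  rw [← hSc, ← hSn, ← Finset.card_powersetCard, ← Finset.card_powersetCard,
    ← Finset.card_product]
  let F : Finset (Fin m) × Finset (Fin m) → Fin m → Bool :=
    fun P i => decide (i ∈ (S \ P.1) ∪ P.2)
  refine Finset.card_le_card_of_injOn F ?_ ?_
  · rintro ⟨B, A⟩ hP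
    rw [Finset.mem_coe, Finset.mem_product, Finset.mem_powersetCard,
      Finset.mem_powersetCard] at hP
    obtain ⟨⟨hB, hBc⟩, hA, hAc⟩ := hP
    dsimp only at hB hBc hA hAc
    have hd : Disjoint (S \ B) A :=
      (Finset.disjoint_left.2 fun i hi hi' =>
        (Finset.mem_compl.1 (hA hi')) (Finset.mem_sdiff.1 hi).1)
    have h1 : numOnes (F (B, A)) = (S.card - B.card) + A.card := by
      rw [← Finset.card_sdiff_of_subset hB, ← Finset.card_union_of_disjoint hd, numOnes]
      congr 1
      ext i
      simp [F]
    have h2 : hammingDist x (F (B, A)) ≤ A.card + B.card := by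
      refine le_trans (Finset.card_le_card ?_) (Finset.card_union_le A B)
      intro i hi
      rw [Finset.mem_filter] at hi
      have hi2 := hi.2
      have hA' : i ∈ A → x i ≠ true := fun h => by
        rw [Ne, ← mS]; exact Finset.mem_compl.1 (hA h)
      by_cases ha : i ∈ A
      · simp [ha]
      · by_cases hb : i ∈ B
        · simp [hb]
        · exfalso
          apply hi2
          simp only [F, Finset.mem_union, Finset.mem_sdiff, ha, hb, mS]
          simp
    have := Finset.card_le_card hB
    rw [Finset.mem_coe, Finset.mem_filter]
    refine ⟨Finset.mem_univ _, ?_, ?_⟩ <;> omega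
  · rintro ⟨B, A⟩ hP ⟨B', A'⟩ hP' e
    rw [Finset.mem_coe, Finset.mem_product, Finset.mem_powersetCard,
      Finset.mem_powersetCard] at hP hP'
    obtain ⟨⟨hB, -⟩, hA, -⟩ := hP
    obtain ⟨⟨hB', -⟩, hA', -⟩ := hP'
    have e' : ∀ i, (i ∈ (S \ B) ∪ A ↔ i ∈ (S \ B') ∪ A') := by
      intro i
      have := congrFun e i
      simpa only [F, decide_eq_decide] using this
    simp only [Finset.mem_union, Finset.mem_sdiff] at e'
    have hA1 : ∀ i, i ∈ A → i ∉ S := fun i h => Finset.mem_compl.1 (hA h)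
    have hA2 : ∀ i, i ∈ A' → i ∉ S := fun i h => Finset.mem_compl.1 (hA' h)
    rw [Prod.mk.injEq]
    constructor
    · ext i
      have := e' i; have := hA1 i; have := hA2 i; have := @hB i; have := @hB' i
      tauto
    · ext i
      have := e' i; have := hA1 i; have := hA2 i; have := @hB i; have := @hB' i
      tauto

theorem choose_le_choose_of_le_half {m d k : ℕ} (hkd : k ≤ d) (hd : 2 * d ≤ m) :
    m.choose k ≤ m.choose d := by
  induction d, hkd using Nat.le_induction with
  | base => exact le_rfl
  | succ d _ ih =>
    exact (ih (by omega)).trans (Nat.choose_le_succ_of_lt_half_left (by omega))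

theorem card_ball_le {m d : ℕ} (hd : 2 * d ≤ m) (y : Fin m → Bool) :
    (Finset.univ.filter fun x : Fin m → Bool => hammingDist x y ≤ d).card ≤
      (m + 1) * m.choose d := by
  calc _ ≤ (Finset.univ.filter fun z : Fin m → Bool => numOnes z ≤ d).card := by
        -- Adding `y` bitwise moves the centre of the ball to the zero word.
        refine Finset.card_le_card_of_injOn (fun x i => xor (x i) (y i)) ?_ ?_
        · intro x hx
          rw [Finset.mem_coe, Finset.mem_filter] at hx ⊢
          refine ⟨Finset.mem_univ _, le_trans (le_of_eq ?_) hx.2⟩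
          unfold numOnes hammingDist
          congr 1
          ext i
          simp
        · intro x _ x' _ e
          funext i
          exact Bool.xor_left_inj.1 (show xor (x i) (y i) = xor (x' i) (y i) from congrFun e i)
    _ ≤ ((Finset.range (d + 1)).biUnion fun t =>
          Finset.univ.filter fun z : Fin m → Bool => numOnes z = t).card := by
        refine Finset.card_le_card fun z hz => ?_
        simp only [Finset.mem_filter, Finset.mem_univ, true_and, Finset.mem_biUnion,
          Finset.mem_range] at hz ⊢
        exact ⟨_, by omega, rfl⟩
    _ ≤ ∑ t ∈ Finset.range (d + 1), m.choose t := by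
        refine Finset.card_biUnion_le.trans (le_of_eq ?_)
        exact Finset.sum_congr rfl fun t _ => card_numOnes_eq m t
    _ ≤ ∑ t ∈ Finset.range (d + 1), m.choose d :=
        Finset.sum_le_sum fun t ht =>
          choose_le_choose_of_le_half (Nat.lt_succ_iff.1 (Finset.mem_range.1 ht)) hd
    _ = (d + 1) * m.choose d := by simp
    _ ≤ _ := Nat.mul_le_mul_right _ (by omega)

/-! ### Greedy coverings -/

open Classical in
/-- Greedy covering: if every point of `S` is hit by a fraction `δ` of `T`, then `k` greedily
chosen points of `T` miss at most a fraction `(1 - δ) ^ k` of `S`. -/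
theorem exists_card_missed_le {X Y : Type*} [Nonempty Y] (S : Finset X) (T : Finset Y)
    (R : X → Y → Prop) {δ : ℝ} (hT : T.Nonempty)
    (h : ∀ x ∈ S, δ * T.card ≤ (T.filter fun y => R x y).card) (hδ : δ ≤ 1) (k : ℕ) :
    ∃ g : ℕ → Y, ((S.filter fun x => ∀ i < k, ¬ R x (g i)).card : ℝ) ≤ (1 - δ) ^ k * S.card := by
  induction k with
  | zero => exact ⟨fun _ => Classical.arbitrary Y, by simp⟩
  | succ k ih =>
    obtain ⟨g, hg⟩ := ih
    set U := S.filter fun x => ∀ i < k, ¬ R x (g i) with hU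
    have hdc := Finset.sum_card_bipartiteAbove_eq_sum_card_bipartiteBelow R (s := U) (t := T)
    have h1 : δ * T.card * U.card ≤ ∑ x ∈ U, ((T.filter fun y => R x y).card : ℝ) := by
      calc δ * T.card * U.card = ∑ x ∈ U, δ * T.card := by simp [mul_comm]
        _ ≤ _ := Finset.sum_le_sum fun x hx => h x (Finset.mem_filter.1 hx).1
    have h2 : ∑ x ∈ U, ((T.filter fun y => R x y).card : ℝ) =
        ∑ y ∈ T, ((U.filter fun x => R x y).card : ℝ) := by
      exact_mod_cast hdc
    have h3 : ∑ y ∈ T, δ * U.card ≤ ∑ y ∈ T, ((U.filter fun x => R x y).card : ℝ) := by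
      rw [← h2]
      refine le_trans (le_of_eq ?_) h1
      rw [Finset.sum_const, nsmul_eq_mul]; ring
    -- By double counting, the points of `T` hit on average at least `δ * U.card` points of `U`, so
    -- some point does.
    obtain ⟨y, _, hy⟩ := Finset.exists_le_of_sum_le hT h3
    refine ⟨Function.update g k y, ?_⟩
    have e : (S.filter fun x => ∀ i < k + 1, ¬ R x (Function.update g k y i)) =
        U.filter fun x => ¬ R x y := by
      ext x
      simp only [hU, Finset.mem_filter]
      constructor
      · rintro ⟨hx, hh⟩
        refine ⟨⟨hx, fun i hi => ?_⟩, ?_⟩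
        · have := hh i (by omega)
          rwa [Function.update_of_ne (by omega)] at this
        · have := hh k (by omega)
          rwa [Function.update_self] at this
      · rintro ⟨⟨hx, hh⟩, hxy⟩
        refine ⟨hx, fun i hi => ?_⟩
        rcases eq_or_ne i k with rfl | hik
        · rwa [Function.update_self]
        · rw [Function.update_of_ne hik]
          exact hh i (by omega)
    rw [e]
    have hsplit := Finset.card_filter_add_card_filter_not (s := U) (fun x => R x y)
    have hsplit' : ((U.filter fun x => R x y).card : ℝ) + (U.filter fun x => ¬ R x y).card =
        U.card := by exact_mod_cast hsplit
    calc ((U.filter fun x => ¬ R x y).card : ℝ) ≤ (1 - δ) * U.card := by linarith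
      _ ≤ (1 - δ) * ((1 - δ) ^ k * S.card) :=
        mul_le_mul_of_nonneg_left hg (by linarith)
      _ = _ := by ring

open Classical in
theorem exists_cover {X Y : Type*} [Nonempty Y] (S : Finset X) (T : Finset Y)
    (R : X → Y → Prop) {δ : ℝ} (hT : T.Nonempty) (hS : S.Nonempty) (hδ0 : 0 < δ)
    (hδ : δ ≤ 1) (h : ∀ x ∈ S, δ * T.card ≤ (T.filter fun y => R x y).card) :
    ∃ (g : ℕ → Y) (k : ℕ), (k : ℝ) ≤ 1 + Real.log S.card / δ ∧
      ∀ x ∈ S, ∃ i < k, R x (g i) := by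
  have hS0 : (0 : ℝ) < S.card := by exact_mod_cast hS.card_pos
  have hS1 : (1 : ℝ) ≤ S.card := by exact_mod_cast hS.card_pos
  have hl : 0 ≤ Real.log S.card / δ := div_nonneg (Real.log_nonneg hS1) hδ0.le
  -- This is the least integer above `log |S| / δ`, so `(1 - δ)^k |S| ≤ exp (log |S| - k δ) < 1`,
  -- and nothing is missed.
  set k := ⌊Real.log S.card / δ⌋₊ + 1 with hk
  obtain ⟨g, hg⟩ := exists_card_missed_le S T R hT h hδ k
  refine ⟨g, k, ?_, ?_⟩
  · rw [hk]; push_cast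
    linarith [Nat.floor_le hl]
  have hk' : Real.log S.card / δ < k := by rw [hk]; push_cast; exact Nat.lt_floor_add_one _
  rw [div_lt_iff₀ hδ0] at hk'
  have lt : (1 - δ) ^ k * S.card < 1 := by
    calc (1 - δ) ^ k * S.card ≤ Real.exp (-δ) ^ k * S.card := by
          have := Real.add_one_le_exp (-δ)
          have h0 : 0 ≤ 1 - δ := by linarith
          gcongr
          linarith
      _ = Real.exp (-(k * δ)) * Real.exp (Real.log S.card) := by
          rw [Real.exp_log hS0, ← Real.exp_nat_mul]; ring_nf
      _ = Real.exp (Real.log S.card - k * δ) := by rw [← Real.exp_add]; ring_nf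
      _ < 1 := by rw [Real.exp_lt_one_iff]; linarith
  have hc : (S.filter fun x => ∀ i < k, ¬ R x (g i)).card = 0 := by
    have := hg.trans_lt lt
    have : (S.filter fun x => ∀ i < k, ¬ R x (g i)).card < 1 := by exact_mod_cast this
    omega
  rw [Finset.card_eq_zero] at hc
  intro x hx
  by_contra hn
  push Not at hn
  have : x ∈ S.filter fun x => ∀ i < k, ¬ R x (g i) := Finset.mem_filter.2 ⟨hx, hn⟩
  rw [hc] at this
  simp at this

theorem exists_weight_cover {m d t : ℕ} (hd : d ≤ m) (htm : t ≤ m) :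
    ∃ (g : ℕ → Fin m → Bool) (k : ℕ),
      (k : ℝ) ≤ (1 + m * (m + 1)) * (1 + (m.choose t : ℝ) / m.choose d) ∧
      ∀ x, numOnes x = t → ∃ i < k, hammingDist x (g i) ≤ d := by
  have hcd : (0 : ℝ) < m.choose d := by exact_mod_cast Nat.choose_pos hd
  have hct : (0 : ℝ) < m.choose t := by exact_mod_cast Nat.choose_pos htm
  have hone : ((1 : ℕ) : ℝ) ≤ (1 + m * (m + 1)) * (1 + (m.choose t : ℝ) / m.choose d) := by
    have h1 : (1 : ℝ) ≤ 1 + m * (m + 1) := by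
      have : (0 : ℝ) ≤ m * (m + 1) := by positivity
      linarith
    have h2 : (1 : ℝ) ≤ 1 + (m.choose t : ℝ) / m.choose d := by
      have : (0 : ℝ) ≤ (m.choose t : ℝ) / m.choose d := by positivity
      linarith
    push_cast
    nlinarith
  -- Outside `d ≤ t ≤ m - d` one ball suffices, around the zero word or the all-ones word.
  rcases lt_or_ge t d with htd | hdt
  · refine ⟨fun _ _ => false, 1, hone, fun x hx => ⟨0, one_pos, ?_⟩⟩
    have : hammingDist x (fun _ => false) = numOnes x := by
      unfold hammingDist numOnes
      congr 1
      ext i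
      simp
    change hammingDist x (fun _ => false) ≤ d
    omega
  rcases lt_or_ge m (t + d) with hmt | htd
  · refine ⟨fun _ _ => true, 1, hone, fun x hx => ⟨0, one_pos, ?_⟩⟩
    have h := Finset.card_filter_add_card_filter_not (s := (Finset.univ : Finset (Fin m)))
      (fun i => x i = true)
    rw [Finset.card_univ, Fintype.card_fin] at h
    have e1 : (Finset.univ.filter fun i => x i = true).card = t := hx
    have e2 : hammingDist x (fun _ => true) =
        (Finset.univ.filter fun i => ¬ x i = true).card := rfl
    change hammingDist x (fun _ => true) ≤ d
    omega
  classical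
  obtain ⟨u, a, hum, had, hut, hc⟩ := exists_centre_weight hdt htd
  have hpos : 0 < u.choose a * (m - u).choose (d - a) := by
    have := Nat.choose_pos hd
    rcases Nat.eq_zero_or_pos (u.choose a * (m - u).choose (d - a)) with h | h
    · rw [h] at hc; omega
    · exact h
  have hau : a ≤ u := by
    by_contra hlt
    rw [Nat.choose_eq_zero_of_lt (not_le.1 hlt)] at hpos
    simp at hpos
  have hbu : d - a ≤ m - u := by
    by_contra hlt
    rw [Nat.choose_eq_zero_of_lt (not_le.1 hlt)] at hpos
    simp at hpos
  obtain ⟨b, rfl⟩ := Nat.exists_eq_add_of_le had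
  obtain ⟨w, rfl⟩ := Nat.exists_eq_add_of_le hau
  rw [Nat.add_sub_cancel_left] at hbu hc
  obtain ⟨c, hcm⟩ := Nat.exists_eq_add_of_le hbu
  obtain rfl : m = w + a + b + c := by omega
  obtain rfl : t = w + b := by omega
  have comm := choose_mul_choose_mul_choose_comm w a b c
  rw [hcm, add_comm a w] at hc
  set M := w + a + b + c with hM
  set S : Finset (Fin M → Bool) := Finset.univ.filter fun x => numOnes x = w + b with hS
  set T : Finset (Fin M → Bool) := Finset.univ.filter fun x => numOnes x = w + a with hT
  have cS : S.card = M.choose (w + b) := card_numOnes_eq _ _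
  have cT : T.card = M.choose (w + a) := card_numOnes_eq _ _
  have hS0 : S.Nonempty := by rw [← Finset.card_pos, cS]; exact Nat.choose_pos htm
  have hT0 : T.Nonempty := by rw [← Finset.card_pos, cT]; exact Nat.choose_pos (by omega)
  -- Now `d = a + b`, the words have weight `w + b` and the centres `w + a`. This `δ` is the
  -- guaranteed fraction of centres near a given word: `comm` transfers to words the bound `hc` on
  -- neighbours of a centre.
  set δ : ℝ := M.choose (a + b) / ((a + b + 1) * M.choose (w + b)) with hδ
  have hδ0 : 0 < δ := by positivity
  have hcover : ∀ x ∈ S, δ * T.card ≤ (T.filter fun y => hammingDist x y ≤ a + b).card := by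
    intro x hx
    have hx' : numOnes x = w + b := (Finset.mem_filter.1 hx).2
    have h1 := choose_mul_choose_le_card_neighbours x a b
    rw [hx', show M - (w + b) = a + c by omega] at h1
    have h2 : (Finset.univ.filter fun y : Fin M → Bool =>
        numOnes y + b = w + b + a ∧ hammingDist x y ≤ a + b) =
        T.filter fun y => hammingDist x y ≤ a + b := by
      ext y
      simp only [hT, Finset.mem_filter, Finset.mem_univ, true_and]
      refine and_congr_left fun _ => ?_
      omega
    rw [h2] at h1
    refine le_trans ?_ (Nat.cast_le.2 h1)
    rw [hδ, cT, div_mul_eq_mul_div, div_le_iff₀ (by positivity)]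
    have h3 : M.choose (a + b) * M.choose (w + a) ≤
        (w + b).choose b * (a + c).choose a * ((a + b + 1) * M.choose (w + b)) := by
      calc M.choose (a + b) * M.choose (w + a)
          ≤ (a + b + 1) * ((w + a).choose a * (b + c).choose b) * M.choose (w + a) :=
            Nat.mul_le_mul_right _ hc
        _ = (a + b + 1) * (M.choose (w + a) * ((w + a).choose a * (b + c).choose b)) := by ring
        _ = _ := by rw [← comm]; ring
    exact_mod_cast h3
  have hδ1 : δ ≤ 1 := by
    obtain ⟨x, hx⟩ := hS0
    have h1 := hcover x hx
    have h2 : ((T.filter fun y => hammingDist x y ≤ a + b).card : ℝ) ≤ T.card :=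
      Nat.cast_le.2 (Finset.card_filter_le _ _)
    have h3 : (0 : ℝ) < T.card := by exact_mod_cast hT0.card_pos
    nlinarith
  obtain ⟨g, k, hk, hg⟩ := exists_cover S T (fun x y => hammingDist x y ≤ a + b) hT0 hS0 hδ0 hδ1
    fun x hx => by convert hcover x hx
  refine ⟨g, k, hk.trans ?_, fun x hx => hg x (Finset.mem_filter.2 ⟨Finset.mem_univ _, hx⟩)⟩
  have hlog : Real.log S.card ≤ M := by
    have h1 : (S.card : ℝ) ≤ 2 ^ M := by
      rw [cS]; exact_mod_cast Nat.choose_le_two_pow _ _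
    have h2 := Real.log_le_log (by rw [cS]; exact hct) h1
    rw [Real.log_pow] at h2
    have h3 : Real.log 2 ≤ 1 := by have := Real.log_two_lt_d9; linarith
    have h4 : (0 : ℝ) ≤ M := Nat.cast_nonneg _
    nlinarith
  have hdM : (a : ℝ) + b ≤ M := by exact_mod_cast hd
  have e : Real.log S.card / δ =
      Real.log S.card * ((a + b) + 1) * (M.choose (w + b) / M.choose (a + b)) := by
    rw [hδ]; field_simp
  rw [e]
  have hlog0 : 0 ≤ Real.log S.card := Real.log_natCast_nonneg _
  have h5 : Real.log S.card * (((a : ℝ) + b) + 1) ≤ M * (M + 1) := by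
    gcongr
  have h6 : (0 : ℝ) ≤ (M.choose (w + b) : ℝ) / M.choose (a + b) := by positivity
  have h7 : (0 : ℝ) ≤ (M : ℝ) * (M + 1) := by positivity
  nlinarith [mul_le_mul_of_nonneg_right h5 h6]

/-! ### A guessing order for all weights -/

theorem hits_iff {D : ℝ} (hD : 0 ≤ D) {m : ℕ} (x y : Fin m → Bool) :
    Hits D x y ↔ hammingDist x y ≤ ⌊(m : ℝ) * D⌋₊ := by
  rw [Hits, Nat.le_floor_iff (by positivity)]

/-- Interleaving the covers of all weight classes gives a guessing order that is good for all
weights at once. -/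
theorem exists_universal_guess {D : ℝ} (hD : 0 ≤ D) {m : ℕ} (hd : ⌊(m : ℝ) * D⌋₊ ≤ m) :
    ∃ g : ℕ → Fin m → Bool, ∀ x, (∃ k, Hits D x (g k)) ∧
      (guesswork D g x : ℝ) ≤ (m + 1) * ((1 + m * (m + 1)) *
        (1 + (m.choose (numOnes x) : ℝ) / m.choose ⌊(m : ℝ) * D⌋₊)) := by
  have h : ∀ t : ℕ, ∃ (g : ℕ → Fin m → Bool) (k : ℕ), t ≤ m →
      (k : ℝ) ≤ (1 + m * (m + 1)) *
        (1 + (m.choose t : ℝ) / m.choose ⌊(m : ℝ) * D⌋₊) ∧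
      ∀ x, numOnes x = t → ∃ i < k, hammingDist x (g i) ≤ ⌊(m : ℝ) * D⌋₊ := by
    intro t
    by_cases ht : t ≤ m
    · obtain ⟨g, k, h1, h2⟩ := exists_weight_cover hd ht
      exact ⟨g, k, fun _ => ⟨h1, h2⟩⟩
    · exact ⟨fun _ _ => true, 0, fun h => absurd h ht⟩
  choose g k hgk using h
  refine ⟨fun i => g (i % (m + 1)) (i / (m + 1)), fun x => ?_⟩
  have ht := numOnes_le x
  obtain ⟨hk, hx⟩ := hgk _ ht
  obtain ⟨i, hi, hdist⟩ := hx x rfl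
  -- The guess number `i` of the cover for weight `t` stands at position `i * (m + 1) + t`, counted
  -- from `0`. As `t ≤ m`, its index counted from `1` is at most `(i + 1) * (m + 1)`.
  have hit : Hits D x (g ((i * (m + 1) + numOnes x) % (m + 1))
      ((i * (m + 1) + numOnes x) / (m + 1))) := by
    have e1 : (i * (m + 1) + numOnes x) % (m + 1) = numOnes x := by
      rw [Nat.mul_add_mod', Nat.mod_eq_of_lt (by omega)]
    have e2 : (i * (m + 1) + numOnes x) / (m + 1) = i := by
      rw [add_comm, Nat.add_mul_div_right _ _ (by omega), Nat.div_eq_of_lt (by omega), zero_add]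
    rw [e1, e2, hits_iff hD]
    exact hdist
  refine ⟨⟨_, hit⟩, ?_⟩
  have h1 : guesswork D (fun i => g (i % (m + 1)) (i / (m + 1))) x ≤ (m + 1) * k (numOnes x) := by
    have := Nat.sInf_le (s := {j | Hits D x (g (j % (m + 1)) (j / (m + 1)))}) hit
    unfold guesswork
    have h2 : (i + 1) * (m + 1) ≤ k (numOnes x) * (m + 1) := Nat.mul_le_mul_right _ hi
    nlinarith
  calc (guesswork D (fun i => g (i % (m + 1)) (i / (m + 1))) x : ℝ)
      ≤ (m + 1) * k (numOnes x) := by exact_mod_cast h1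
    _ ≤ _ := by gcongr

/-! ### Admissible attacks and the optimal moment -/

theorem failureProb_nonneg {p : ℝ} (hp0 : 0 ≤ p) (hp1 : p ≤ 1) (m : ℕ) (A : Finset ℝ) :
    0 ≤ failureProb p m A :=
  Finset.sum_nonneg fun x _ => by
    split_ifs
    exacts [wordProb_nonneg hp0 hp1 x, le_rfl]

open Classical in
theorem one_sub_failureProb (p : ℝ) (m : ℕ) (A : Finset ℝ) : 1 - failureProb p m A =
    ∑ x : Fin m → Bool, if wordType x ∈ A then 0 else wordProb p x := by
  rw [sub_eq_iff_eq_add, ← sum_wordProb p m, failureProb, ← Finset.sum_add_distrib]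
  refine Finset.sum_congr rfl fun x _ => ?_
  split_ifs <;> simp

/-- Every guesswork is at least `1`. This supplies the lower bound that the infimum `sInf` needs and
keeps the logarithm in the rate monotone. -/
theorem one_le_moment {p D ρ : ℝ} (hp0 : 0 ≤ p) (hp1 : p ≤ 1) (hρ : 0 ≤ ρ) {m : ℕ}
    (A : Finset ℝ) (hA : failureProb p m A < 1) (g : ℕ → Fin m → Bool) :
    1 ≤ moment p D ρ A g := by
  rw [moment, one_le_div (by linarith), one_sub_failureProb]
  refine Finset.sum_le_sum fun x _ => ?_
  split_ifs
  · exact le_rfl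
  · refine le_mul_of_one_le_right (wordProb_nonneg hp0 hp1 x) (Real.one_le_rpow ?_ hρ)
    unfold guesswork
    push_cast
    linarith [Nat.cast_nonneg (α := ℝ) (sInf {k | Hits D x (g k)})]

theorem le_optMoment {p D ρ c : ℝ} {α : ℝ≥0∞} {m : ℕ}
    (hne : ∃ (A : Finset ℝ) (g : ℕ → Fin m → Bool), Admissible p D α A g)
    (h : ∀ (A : Finset ℝ) (g : ℕ → Fin m → Bool), Admissible p D α A g →
      c ≤ moment p D ρ A g) : c ≤ optMoment p D ρ α m := by
  obtain ⟨A, g, hAg⟩ := hne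
  refine le_csInf ⟨_, A, g, hAg, rfl⟩ ?_
  rintro e ⟨A, g, hAg, rfl⟩
  exact h A g hAg

theorem optMoment_le_moment {p D ρ : ℝ} (hp0 : 0 ≤ p) (hp1 : p ≤ 1) (hρ : 0 ≤ ρ) {α : ℝ≥0∞}
    {m : ℕ} {A : Finset ℝ} {g : ℕ → Fin m → Bool} (hAg : Admissible p D α A g) :
    optMoment p D ρ α m ≤ moment p D ρ A g := by
  refine csInf_le ⟨0, ?_⟩ ⟨A, g, hAg, rfl⟩
  rintro e ⟨A, g, hAg, rfl⟩
  exact zero_le_one.trans (one_le_moment hp0 hp1 hρ A hAg.failure_lt_one g)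

theorem failureProb_empty (p : ℝ) (m : ℕ) : failureProb p m ∅ = 0 := by
  simp [failureProb]

theorem failureBound_nonneg (α : ℝ≥0∞) (m : ℕ) : 0 ≤ failureBound α m := by
  unfold failureBound
  split_ifs <;> positivity

theorem exists_admissible {p D : ℝ} (hD : 0 ≤ D) (hD1 : D ≤ 1) (α : ℝ≥0∞) (m : ℕ) :
    ∃ (A : Finset ℝ) (g : ℕ → Fin m → Bool), Admissible p D α A g := by
  have hd : ⌊(m : ℝ) * D⌋₊ ≤ m :=
    Nat.floor_le_of_le (mul_le_of_le_one_right (Nat.cast_nonneg _) hD1)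
  obtain ⟨g, hg⟩ := exists_universal_guess hD hd
  refine ⟨∅, g, ?_, ?_, fun x _ => (hg x).1⟩ <;> rw [failureProb_empty]
  · exact failureBound_nonneg α m
  · exact one_pos

theorem one_le_optMoment {p D ρ : ℝ} (hp0 : 0 ≤ p) (hp1 : p ≤ 1) (hρ : 0 ≤ ρ) (hD : 0 ≤ D)
    (hD1 : D ≤ 1) (α : ℝ≥0∞) (m : ℕ) : 1 ≤ optMoment p D ρ α m :=
  le_optMoment (exists_admissible hD hD1 α m) fun A g hAg =>
    one_le_moment hp0 hp1 hρ A hAg.failure_lt_one g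

/-! ### Upper bound for the moment -/

section

variable {ρ p D s : ℝ}

open Classical in
-- After tilting, class `t` contributes `b^(1+ρ)` with `b` the Binomial(`m`, `s`) mass at `t`. As `b
-- ≤ 1`, this is at most `b`, and these masses sum to `1`, so no polynomial factor is lost.
theorem sum_prob_mul_choose_rpow_le (hρ : 0 < ρ) (hp0 : 0 < p) (hp1 : p < 1) (hs0 : 0 < s)
    (hs1 : s < 1) {m : ℕ} {A : Finset ℝ}
    (hA : ∀ x : Fin m → Bool, wordType x ∉ A → ((numOnes x : ℝ) - s * m) *
      (Real.log p - Real.log (1 - p) - (1 + ρ) * (Real.log s - Real.log (1 - s))) ≤ 0) :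
    (∑ x : Fin m → Bool, if wordType x ∈ A then 0 else
      wordProb p x * (m.choose (numOnes x) : ℝ) ^ ρ) ≤
      (2 : ℝ) ^ ((m : ℝ) * (ρ * entropy s - binKL s p)) := by
  have hs' : 0 < 1 - s := by linarith
  have step : ∀ x : Fin m → Bool, (if wordType x ∈ A then 0 else
      wordProb p x * (m.choose (numOnes x) : ℝ) ^ ρ) ≤
      (2 : ℝ) ^ ((m : ℝ) * (ρ * entropy s - binKL s p)) *
        ((s ^ numOnes x * (1 - s) ^ (m - numOnes x)) ^ (1 + ρ) *
          (m.choose (numOnes x) : ℝ) ^ ρ) := by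
    intro x
    split_ifs with h
    · positivity
    · rw [← mul_assoc, wordProb_eq]
      exact mul_le_mul_of_nonneg_right
        (prob_le_tilted hp0 hp1 hs0 hs1 (numOnes_le x) (hA x h)) (by positivity)
  refine (Finset.sum_le_sum fun x _ => step x).trans ?_
  rw [← Finset.mul_sum]
  refine mul_le_of_le_one_right (by positivity) ?_
  rw [sum_apply_numOnes m fun t => (s ^ t * (1 - s) ^ (m - t)) ^ (1 + ρ) *
    (m.choose t : ℝ) ^ ρ]
  refine le_trans ?_ (sum_binomial s m).le
  refine Finset.sum_le_sum fun t ht => ?_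
  have htm : t ≤ m := Nat.lt_succ_iff.1 (Finset.mem_range.1 ht)
  have hc : (0 : ℝ) < m.choose t := by exact_mod_cast Nat.choose_pos htm
  set b := (m.choose t : ℝ) * (s ^ t * (1 - s) ^ (m - t)) with hb
  have hb0 : 0 < b := by positivity
  have hb1 : b ≤ 1 := by
    rw [← sum_binomial s m]
    exact Finset.single_le_sum
      (f := fun t => (m.choose t : ℝ) * (s ^ t * (1 - s) ^ (m - t)))
      (fun _ _ => by positivity) ht
  calc (m.choose t : ℝ) * ((s ^ t * (1 - s) ^ (m - t)) ^ (1 + ρ) * (m.choose t : ℝ) ^ ρ)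
      = b ^ (1 + ρ) := by
        rw [hb, Real.mul_rpow hc.le (by positivity), Real.rpow_add hc, Real.rpow_one]
        ring
    _ ≤ b ^ (1 : ℝ) := Real.rpow_le_rpow_of_exponent_ge hb0 hb1 (by linarith)
    _ = b := Real.rpow_one b

open Classical in
-- Chernoff bound, from the tilting inequality at `ρ = 0`. The absence of a polynomial factor is
-- essential: the skipped set must meet the bound `2^(-α m)` exactly.
theorem failureProb_le (hp0 : 0 < p) (hp1 : p < 1) (hs0 : 0 < s) (hs1 : s < 1) (hps : p ≤ s)
    {m : ℕ} {A : Finset ℝ} (hA : ∀ x : Fin m → Bool, wordType x ∈ A → s * m ≤ numOnes x) :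
    failureProb p m A ≤ (2 : ℝ) ^ (-(binKL s p * m)) := by
  have hs' : 0 < 1 - s := by linarith
  have step : ∀ x : Fin m → Bool, (if wordType x ∈ A then wordProb p x else 0) ≤
      (2 : ℝ) ^ (-(binKL s p * m)) * (s ^ numOnes x * (1 - s) ^ (m - numOnes x)) := by
    intro x
    split_ifs with h
    · have := prob_le_tilted (ρ := 0) hp0 hp1 hs0 hs1 (numOnes_le x) (mul_nonpos_of_nonneg_of_nonpos
        (sub_nonneg.2 (hA x h)) (by
          have h1 := Real.log_le_log hp0 hps
          have h2 := Real.log_le_log hs' (by linarith : 1 - s ≤ 1 - p)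
          linarith))
      rw [add_zero, Real.rpow_one] at this
      rw [wordProb_eq]
      refine this.trans (le_of_eq ?_)
      congr 2
      ring
    · positivity
  refine (Finset.sum_le_sum fun x _ => step x).trans (le_of_eq ?_)
  rw [← Finset.mul_sum, sum_apply_numOnes m fun t => s ^ t * (1 - s) ^ (m - t), sum_binomial,
    mul_one]

open Classical in
theorem optMoment_le (hρ : 0 < ρ) (hp0 : 0 < p) (hp1 : p < 1) (hD : 0 ≤ D) (hD2 : D ≤ 1 / 2)
    (hs0 : 0 < s) (hs1 : s < 1) (hφ : ρ * entropy D ≤ ρ * entropy s - binKL s p) {α : ℝ≥0∞}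
    {m : ℕ} (hm : 0 < m) {A : Finset ℝ}
    (hA : ∀ x : Fin m → Bool, wordType x ∉ A → ((numOnes x : ℝ) - s * m) *
      (Real.log p - Real.log (1 - p) - (1 + ρ) * (Real.log s - Real.log (1 - s))) ≤ 0)
    (hF : failureProb p m A ≤ failureBound α m) (hF2 : failureProb p m A ≤ 1 / 2) :
    optMoment p D ρ α m ≤ 4 * (2 * ((m : ℝ) + 1) ^ 3) ^ ρ *
      ((2 : ℝ) ^ ((m : ℝ) * (ρ * entropy s - binKL s p)) /
        (m.choose ⌊(m : ℝ) * D⌋₊ : ℝ) ^ ρ) := by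
  have hm' : (0 : ℝ) < m := by exact_mod_cast hm
  have hfl : (⌊(m : ℝ) * D⌋₊ : ℝ) ≤ m * D := Nat.floor_le (by positivity)
  have hd : ⌊(m : ℝ) * D⌋₊ ≤ m :=
    Nat.floor_le_of_le (mul_le_of_le_one_right (Nat.cast_nonneg _) (by linarith))
  obtain ⟨g, hg⟩ := exists_universal_guess hD hd
  set C : ℝ := (m.choose ⌊(m : ℝ) * D⌋₊ : ℝ) with hC
  have hC0 : 0 < C := by rw [hC]; exact_mod_cast Nat.choose_pos hd
  set E : ℝ := (2 : ℝ) ^ ((m : ℝ) * (ρ * entropy s - binKL s p)) with hE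
  set Q : ℝ := (2 * ((m : ℝ) + 1) ^ 3) ^ ρ with hQ
  have hQ0 : 0 < Q := by positivity
  -- This is where `hφ` enters: it lets the summand `1` in the guesswork bound, which dominates for
  -- classes smaller than `C`, be absorbed into `E / C ^ ρ`.
  have hCE : C ^ ρ ≤ E := by
    have h1 := logb_choose_le hm hd
    have hent : entropy ((⌊(m : ℝ) * D⌋₊ : ℝ) / m) ≤ entropy D := by
      refine div_le_div_of_nonneg_right ?_ (Real.log_pos one_lt_two).le
      have hle : (⌊(m : ℝ) * D⌋₊ : ℝ) / m ≤ D := by rw [div_le_iff₀ hm']; linarith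
      refine Real.binEntropy_strictMonoOn.monotoneOn ⟨by positivity, by linarith⟩
        ⟨hD, by linarith⟩ hle
    rw [hE, ← Real.logb_le_logb one_lt_two (by positivity) (by positivity),
      Real.logb_rpow two_pos (by norm_num), Real.logb_rpow_eq_mul_logb_of_pos hC0]
    calc ρ * Real.logb 2 C ≤ ρ * (m * entropy D) := by
          gcongr
          exact h1.trans (by gcongr)
      _ = m * (ρ * entropy D) := by ring
      _ ≤ _ := by gcongr
  have adm : Admissible p D α A g := ⟨hF, by linarith, fun x _ => (hg x).1⟩
  refine (optMoment_le_moment hp0.le hp1.le hρ.le adm).trans ?_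
  rw [moment, div_le_iff₀ (by linarith)]
  have step : ∀ x : Fin m → Bool,
      (if wordType x ∈ A then 0 else wordProb p x * (guesswork D g x : ℝ) ^ ρ) ≤
      Q * (wordProb p x + 1 / C ^ ρ * (if wordType x ∈ A then 0 else
        wordProb p x * (m.choose (numOnes x) : ℝ) ^ ρ)) := by
    intro x
    have hw := wordProb_nonneg hp0.le hp1.le x
    split_ifs with h
    · rw [mul_zero, add_zero]; positivity
    · set y : ℝ := (m.choose (numOnes x) : ℝ) / C with hy
      have hy0 : 0 ≤ y := by positivity
      have h1 : (guesswork D g x : ℝ) ≤ 2 * ((m : ℝ) + 1) ^ 3 * max 1 y := by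
        refine (hg x).2.trans ?_
        have a1 : 1 + y ≤ 2 * max 1 y := by
          have := le_max_left 1 y; have := le_max_right 1 y; linarith
        have a2 : 1 + (m : ℝ) * (m + 1) ≤ (m + 1) ^ 2 := by nlinarith
        calc ((m : ℝ) + 1) * ((1 + m * (m + 1)) * (1 + y))
            ≤ ((m : ℝ) + 1) * ((m + 1) ^ 2 * (2 * max 1 y)) := by gcongr
          _ = _ := by ring
      have h2 : (max 1 y) ^ ρ ≤ 1 + y ^ ρ := by
        rcases le_total 1 y with h | h
        · rw [max_eq_right h]; linarith
        · rw [max_eq_left h, Real.one_rpow]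
          have := Real.rpow_nonneg hy0 ρ
          linarith
      have h3 : (guesswork D g x : ℝ) ^ ρ ≤ Q * (1 + y ^ ρ) := by
        calc (guesswork D g x : ℝ) ^ ρ ≤ (2 * ((m : ℝ) + 1) ^ 3 * max 1 y) ^ ρ :=
              Real.rpow_le_rpow (Nat.cast_nonneg _) h1 hρ.le
          _ = Q * (max 1 y) ^ ρ := by
              rw [Real.mul_rpow (by positivity) (by positivity)]
          _ ≤ _ := by gcongr
      calc wordProb p x * (guesswork D g x : ℝ) ^ ρ ≤ wordProb p x * (Q * (1 + y ^ ρ)) := by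
            gcongr
        _ = _ := by
            rw [hy, Real.div_rpow (Nat.cast_nonneg _) hC0.le]; ring
  have key := sum_prob_mul_choose_rpow_le hρ hp0 hp1 hs0 hs1 hA
  calc _ ≤ ∑ x : Fin m → Bool, Q * (wordProb p x + 1 / C ^ ρ *
        (if wordType x ∈ A then 0 else wordProb p x * (m.choose (numOnes x) : ℝ) ^ ρ)) :=
        Finset.sum_le_sum fun x _ => step x
    _ = Q * (1 + 1 / C ^ ρ * ∑ x : Fin m → Bool,
        (if wordType x ∈ A then 0 else wordProb p x * (m.choose (numOnes x) : ℝ) ^ ρ)) := by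
        rw [← Finset.mul_sum, Finset.sum_add_distrib, sum_wordProb, ← Finset.mul_sum]
    _ ≤ Q * (E / C ^ ρ + 1 / C ^ ρ * E) := by
        have hCp : 0 < C ^ ρ := by positivity
        have := (one_le_div hCp).2 hCE
        gcongr
    -- One factor `2` of the `4` comes from the two equal summands, the other from conditioning on
    -- an event of probability at least `1/2`.
    _ = 4 * Q * (E / C ^ ρ) * (1 / 2) := by ring
    _ ≤ 4 * Q * (E / C ^ ρ) * (1 - failureProb p m A) := by
        gcongr
        linarith

theorem tendsto_floor_mul_div (hD : 0 ≤ D) :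
    Tendsto (fun m : ℕ => ((⌊(m : ℝ) * D⌋₊ : ℕ) : ℝ) / m) atTop (𝓝 D) := by
  have := (tendsto_nat_floor_mul_div_atTop hD).comp (tendsto_natCast_atTop_atTop (R := ℝ))
  refine this.congr fun m => ?_
  simp [mul_comm]

/-- An eventual bound of the form `poly(m) * 2 ^ (m φ) / C(m, ⌊mD⌋) ^ ρ` bounds the rate. -/
theorem tendsto_upper_rate (ρ φ : ℝ) (hD : 0 ≤ D) (hD1 : D ≤ 1) :
    Tendsto (fun m : ℕ => 1 / (m : ℝ) * Real.logb 2 (4 * (2 * ((m : ℝ) + 1) ^ 3) ^ ρ *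
      ((2 : ℝ) ^ ((m : ℝ) * φ) / (m.choose ⌊(m : ℝ) * D⌋₊ : ℝ) ^ ρ))) atTop
      (𝓝 (φ - ρ * entropy D)) := by
  have hd : ∀ m : ℕ, ⌊(m : ℝ) * D⌋₊ ≤ m := fun m =>
    Nat.floor_le_of_le (mul_le_of_le_one_right (Nat.cast_nonneg _) hD1)
  have h1 := (tendsto_logb_choose hd (tendsto_floor_mul_div hD)).const_mul ρ
  have h2 := tendsto_logb_succ_div.const_mul (3 * ρ)
  have h3 := (tendsto_one_div_atTop_nhds_zero_nat (𝕜 := ℝ)).const_mul (2 + ρ)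
  have h4 := ((h3.add h2).add_const φ).sub h1
  rw [mul_zero, mul_zero, add_zero, zero_add] at h4
  refine h4.congr' ?_
  filter_upwards [eventually_gt_atTop 0] with m hm
  have hm' : (m : ℝ) ≠ 0 := by positivity
  have hc : (0 : ℝ) < m.choose ⌊(m : ℝ) * D⌋₊ := by exact_mod_cast Nat.choose_pos (hd m)
  have e4 : Real.logb 2 4 = 2 := by
    rw [show (4 : ℝ) = 2 ^ (2 : ℝ) by norm_num, Real.logb_rpow two_pos (by norm_num)]
  have e2 : Real.logb 2 2 = 1 := Real.logb_self_eq_one one_lt_two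
  rw [Real.logb_mul (by positivity) (by positivity), Real.logb_mul (by positivity) (by positivity),
    Real.logb_div (by positivity) (by positivity), Real.logb_rpow two_pos (by norm_num),
    Real.logb_rpow_eq_mul_logb_of_pos (by positivity), Real.logb_rpow_eq_mul_logb_of_pos hc,
    Real.logb_mul (by positivity) (by positivity), Real.logb_pow, e4, e2]
  field_simp
  push_cast
  ring

end

/-! ### Lower bound for the moment -/

section

variable {ρ p D : ℝ}

theorem wordProb_mul_choose_le_failureProb (hp0 : 0 ≤ p) (hp1 : p ≤ 1) {m t : ℕ} {A : Finset ℝ}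
    (h : (t : ℝ) / m ∈ A) : (m.choose t : ℝ) * (p ^ t * (1 - p) ^ (m - t)) ≤ failureProb p m A := by
  rw [← card_numOnes_eq, ← nsmul_eq_mul, ← Finset.sum_const, failureProb, Finset.sum_filter]
  refine Finset.sum_le_sum fun x _ => ?_
  have := wordProb_nonneg hp0 hp1 x
  split_ifs with h1 h2 h2
  · rw [wordProb_eq, h1]
  · rw [wordType, h1] at h2
    exact absurd h h2
  · exact this
  · exact le_rfl

open Classical in
theorem card_guesswork_le (hD : 0 ≤ D) {m : ℕ} (hd : 2 * ⌊(m : ℝ) * D⌋₊ ≤ m)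
    (g : ℕ → Fin m → Bool) (S : Finset (Fin m → Bool)) (hS : ∀ x ∈ S, ∃ k, Hits D x (g k))
    (k : ℕ) : (S.filter fun x => guesswork D g x ≤ k).card ≤
      k * ((m + 1) * m.choose ⌊(m : ℝ) * D⌋₊) := by
  calc _ ≤ ((Finset.range k).biUnion fun i => Finset.univ.filter fun x : Fin m → Bool =>
          hammingDist x (g i) ≤ ⌊(m : ℝ) * D⌋₊).card := by
        refine Finset.card_le_card fun x hx => ?_
        obtain ⟨hxS, hxk⟩ := Finset.mem_filter.1 hx
        rw [Finset.mem_biUnion]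
        refine ⟨sInf {j | Hits D x (g j)}, Finset.mem_range.2 hxk, ?_⟩
        rw [Finset.mem_filter, ← hits_iff hD]
        exact ⟨Finset.mem_univ _, Nat.sInf_mem (hS x hxS)⟩
    _ ≤ ∑ i ∈ Finset.range k, (m + 1) * m.choose ⌊(m : ℝ) * D⌋₊ :=
        Finset.card_biUnion_le.trans (Finset.sum_le_sum fun i _ => card_ball_le hd _)
    _ = _ := by simp

open Classical in
/-- A weight class that is not skipped bounds the moment from below. -/
theorem le_moment_of_not_mem (hρ : 0 < ρ) (hp0 : 0 < p) (hp1 : p < 1) (hD : 0 ≤ D)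
    {α : ℝ≥0∞} {m t : ℕ} (hd : 2 * ⌊(m : ℝ) * D⌋₊ ≤ m) {A : Finset ℝ}
    {g : ℕ → Fin m → Bool} (hAg : Admissible p D α A g) (htA : (t : ℝ) / m ∉ A) :
    p ^ t * (1 - p) ^ (m - t) * (m.choose t / 2) *
      (m.choose t / (2 * ((m + 1) * m.choose ⌊(m : ℝ) * D⌋₊))) ^ ρ ≤ moment p D ρ A g := by
  have hp' : 0 < 1 - p := by linarith
  set d := ⌊(m : ℝ) * D⌋₊ with hdd
  have hC : (0 : ℝ) < m.choose d := by exact_mod_cast Nat.choose_pos (by omega : d ≤ m)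
  set V : ℝ := (m + 1) * m.choose d with hV
  have hV0 : 0 < V := by positivity
  set N : ℝ := (m.choose t : ℝ) with hN
  have hN0 : 0 ≤ N := Nat.cast_nonneg _
  -- With `V` bounding the size of a ball, the first `k` guesses reach at most `k V ≤ N / 2` words
  -- of the class; the others need at least `k + 1 ≥ N / (2V)` guesses.
  set k := ⌊N / (2 * V)⌋₊ with hk
  have hk1 : (k : ℝ) ≤ N / (2 * V) := Nat.floor_le (by positivity)
  have hk2 : N / (2 * V) ≤ k + 1 := (Nat.lt_floor_add_one _).le
  set T : Finset (Fin m → Bool) := Finset.univ.filter fun x => numOnes x = t with hT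
  have hTA : ∀ x ∈ T, wordType x ∉ A := by
    intro x hx
    rwa [wordType, (Finset.mem_filter.1 hx).2]
  have hcard := card_guesswork_le hD hd g T (fun x hx => hAg.hits x (hTA x hx)) k
  have hcard' : ((T.filter fun x => guesswork D g x ≤ k).card : ℝ) ≤ k * V := by
    rw [hV]; exact_mod_cast hcard
  have hsplit := Finset.card_filter_add_card_filter_not (s := T) (fun x => guesswork D g x ≤ k)
  have hsplit' : ((T.filter fun x => guesswork D g x ≤ k).card : ℝ) +
      (T.filter fun x => ¬ guesswork D g x ≤ k).card = N := by
    rw [hN, ← card_numOnes_eq]; exact_mod_cast hsplit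
  have hkV : k * V ≤ N / 2 := by
    calc k * V ≤ N / (2 * V) * V := by gcongr
      _ = N / 2 := by field_simp
  have hF0 := failureProb_nonneg hp0.le hp1.le m A
  have hF1 := hAg.failure_lt_one
  have hnum : p ^ t * (1 - p) ^ (m - t) * (N / 2) * (N / (2 * V)) ^ ρ ≤
      ∑ x : Fin m → Bool, if wordType x ∈ A then 0 else
        wordProb p x * (guesswork D g x : ℝ) ^ ρ := by
    calc p ^ t * (1 - p) ^ (m - t) * (N / 2) * (N / (2 * V)) ^ ρ
        ≤ p ^ t * (1 - p) ^ (m - t) *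
          (T.filter fun x => ¬ guesswork D g x ≤ k).card * (N / (2 * V)) ^ ρ := by
          gcongr
          linarith
      _ = ∑ x ∈ T.filter fun x => ¬ guesswork D g x ≤ k,
          p ^ t * (1 - p) ^ (m - t) * (N / (2 * V)) ^ ρ := by
          rw [Finset.sum_const, nsmul_eq_mul]; ring
      _ ≤ ∑ x ∈ T.filter fun x => ¬ guesswork D g x ≤ k, (if wordType x ∈ A then 0 else
          wordProb p x * (guesswork D g x : ℝ) ^ ρ) := by
          refine Finset.sum_le_sum fun x hx => ?_
          obtain ⟨hxT, hxk⟩ := Finset.mem_filter.1 hx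
          rw [if_neg (hTA x hxT), wordProb_eq, (Finset.mem_filter.1 hxT).2]
          have h1 : (k : ℝ) + 1 ≤ guesswork D g x := by exact_mod_cast not_le.1 hxk
          gcongr
          linarith
      _ ≤ _ := by
          refine Finset.sum_le_univ_sum_of_nonneg fun x => ?_
          have := wordProb_nonneg hp0.le hp1.le x
          split_ifs <;> positivity
  rw [moment, le_div_iff₀ (by linarith)]
  refine le_trans ?_ hnum
  -- Conditioning divides by at most `1`, so it can only raise the moment.
  exact mul_le_of_le_one_right (by positivity) (by linarith)

theorem tendsto_logb_prob_mul_choose (hp0 : 0 < p) (hp1 : p < 1) {q : ℝ} (hq0 : 0 ≤ q)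
    (hq1 : q ≤ 1) :
    Tendsto (fun m : ℕ => 1 / (m : ℝ) * Real.logb 2 ((m.choose ⌊(m : ℝ) * q⌋₊ : ℝ) *
      (p ^ ⌊(m : ℝ) * q⌋₊ * (1 - p) ^ (m - ⌊(m : ℝ) * q⌋₊)))) atTop (𝓝 (-binKL q p)) := by
  have hp' : 0 < 1 - p := by linarith
  have ht : ∀ m : ℕ, ⌊(m : ℝ) * q⌋₊ ≤ m := fun m =>
    Nat.floor_le_of_le (mul_le_of_le_one_right (Nat.cast_nonneg _) hq1)
  have h0 := tendsto_floor_mul_div hq0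
  have h1 := tendsto_logb_choose ht h0
  have h2 := (h0.mul_const (Real.logb 2 p)).add
    ((h0.const_sub 1).mul_const (Real.logb 2 (1 - p)))
  have h3 := h1.add h2
  have e : entropy q + (q * Real.logb 2 p + (1 - q) * Real.logb 2 (1 - p)) = -binKL q p := by
    have l := (Real.log_pos one_lt_two).ne'
    refine mul_right_cancel₀ l ?_
    rw [neg_mul, binKL_mul_log_two hp0 hp1, add_mul, entropy_mul_log_two, Real.logb, Real.logb]
    field_simp
    ring
  rw [e] at h3
  refine h3.congr' ?_
  filter_upwards [eventually_gt_atTop 0] with m hm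
  have hm' : (m : ℝ) ≠ 0 := by positivity
  have hc : (0 : ℝ) < m.choose ⌊(m : ℝ) * q⌋₊ := by exact_mod_cast Nat.choose_pos (ht m)
  rw [Real.logb_mul hc.ne' (by positivity), Real.logb_mul (by positivity) (by positivity),
    Real.logb_pow, Real.logb_pow, Nat.cast_sub (ht m)]
  field_simp

theorem tendsto_lower_rate (ρ : ℝ) (hp0 : 0 < p) (hp1 : p < 1) (hD : 0 ≤ D) (hD1 : D ≤ 1)
    {q : ℝ} (hq0 : 0 ≤ q) (hq1 : q ≤ 1) :
    Tendsto (fun m : ℕ => 1 / (m : ℝ) * Real.logb 2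
      (p ^ ⌊(m : ℝ) * q⌋₊ * (1 - p) ^ (m - ⌊(m : ℝ) * q⌋₊) * (m.choose ⌊(m : ℝ) * q⌋₊ / 2) *
      (m.choose ⌊(m : ℝ) * q⌋₊ / (2 * ((m + 1) * m.choose ⌊(m : ℝ) * D⌋₊))) ^ ρ)) atTop
      (𝓝 (ρ * entropy q - binKL q p - ρ * entropy D)) := by
  have hp' : 0 < 1 - p := by linarith
  have ht : ∀ m : ℕ, ⌊(m : ℝ) * q⌋₊ ≤ m := fun m =>
    Nat.floor_le_of_le (mul_le_of_le_one_right (Nat.cast_nonneg _) hq1)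
  have hd : ∀ m : ℕ, ⌊(m : ℝ) * D⌋₊ ≤ m := fun m =>
    Nat.floor_le_of_le (mul_le_of_le_one_right (Nat.cast_nonneg _) hD1)
  have h1 := tendsto_logb_prob_mul_choose hp0 hp1 hq0 hq1
  have h2 := tendsto_logb_choose ht (tendsto_floor_mul_div hq0)
  have h3 := tendsto_logb_choose hd (tendsto_floor_mul_div hD)
  have h4 := tendsto_one_div_atTop_nhds_zero_nat (𝕜 := ℝ)
  have h5 := (h1.sub h4).add ((((h2.sub h4).sub tendsto_logb_succ_div).sub h3).const_mul ρ)
  have e : -binKL q p - 0 + ρ * (entropy q - 0 - 0 - entropy D) =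
      ρ * entropy q - binKL q p - ρ * entropy D := by ring
  rw [e] at h5
  refine h5.congr' ?_
  filter_upwards [eventually_gt_atTop 0] with m hm
  have hm' : (m : ℝ) ≠ 0 := by positivity
  have hc : (0 : ℝ) < m.choose ⌊(m : ℝ) * q⌋₊ := by exact_mod_cast Nat.choose_pos (ht m)
  have hc' : (0 : ℝ) < m.choose ⌊(m : ℝ) * D⌋₊ := by exact_mod_cast Nat.choose_pos (hd m)
  have e2 : Real.logb 2 2 = 1 := Real.logb_self_eq_one one_lt_two
  have key : ∀ w N V : ℝ, 0 < w → 0 < N → 0 < V →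
      1 / (m : ℝ) * Real.logb 2 (N * w) - 1 / m + ρ * (1 / m * Real.logb 2 N - 1 / m -
        1 / m * Real.logb 2 (m + 1) - 1 / m * Real.logb 2 V) =
      1 / m * Real.logb 2 (w * (N / 2) * (N / (2 * ((m + 1) * V))) ^ ρ) := by
    intro w N V hw hN hV
    have e3 : Real.logb 2 (N / (2 * ((m + 1) * V))) =
        Real.logb 2 N - (1 + (Real.logb 2 (m + 1) + Real.logb 2 V)) := by
      rw [Real.logb_div (by positivity) (by positivity), Real.logb_mul two_ne_zero (by positivity),
        Real.logb_mul (by positivity) (by positivity), e2]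
    rw [Real.logb_mul (x := w * (N / 2)) (by positivity) (by positivity),
      Real.logb_rpow_eq_mul_logb_of_pos (by positivity), e3,
      Real.logb_mul hN.ne' hw.ne', Real.logb_mul hw.ne' (by positivity),
      Real.logb_div hN.ne' two_ne_zero, e2]
    ring
  exact key _ _ _ (by positivity) hc hc'

/-- The weight class of type close to `q` cannot be skipped if `D(q‖p) < α`. -/
theorem eventually_lt_optRate (hρ : 0 < ρ) (hp0 : 0 < p) (hp1 : p < 1) (hD : 0 ≤ D)
    (hD2 : D ≤ 1 / 2) {q : ℝ} (hq0 : 0 ≤ q) (hq1 : q ≤ 1) {α : ℝ≥0∞}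
    (hα : α ≠ ⊤ → binKL q p < α.toReal) {c : ℝ}
    (hc : c < ρ * entropy q - binKL q p - ρ * entropy D) :
    ∀ᶠ m : ℕ in atTop, c < optRate p D ρ α m := by
  have hp' : 0 < 1 - p := by linarith
  have ht : ∀ m : ℕ, ⌊(m : ℝ) * q⌋₊ ≤ m := fun m =>
    Nat.floor_le_of_le (mul_le_of_le_one_right (Nat.cast_nonneg _) hq1)
  have h1 := (tendsto_lower_rate ρ hp0 hp1 hD (by linarith) hq0 hq1).eventually_const_lt hc
  -- The class has probability exponent `-D(q‖p) > -α`, so it alone eventually exceeds the allowed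
  -- failure.
  have h2 : ∀ᶠ m : ℕ in atTop, failureBound α m < (m.choose ⌊(m : ℝ) * q⌋₊ : ℝ) *
      (p ^ ⌊(m : ℝ) * q⌋₊ * (1 - p) ^ (m - ⌊(m : ℝ) * q⌋₊)) := by
    have pos : ∀ m : ℕ, 0 < (m.choose ⌊(m : ℝ) * q⌋₊ : ℝ) *
      (p ^ ⌊(m : ℝ) * q⌋₊ * (1 - p) ^ (m - ⌊(m : ℝ) * q⌋₊)) := by
      intro m
      have : (0 : ℝ) < m.choose ⌊(m : ℝ) * q⌋₊ := by exact_mod_cast Nat.choose_pos (ht m)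
      positivity
    by_cases h : α = ⊤
    · refine Eventually.of_forall fun m => ?_
      rw [failureBound, if_pos h]
      exact pos m
    · have := (tendsto_logb_prob_mul_choose hp0 hp1 hq0 hq1).eventually_const_lt
        (neg_lt_neg (hα h))
      filter_upwards [this, eventually_gt_atTop 0] with m hm hm0
      have hm' : (0 : ℝ) < m := by exact_mod_cast hm0
      rw [failureBound, if_neg h, ← Real.logb_lt_logb_iff one_lt_two (by positivity) (pos m),
        Real.logb_rpow two_pos (by norm_num)]
      rw [one_div, inv_mul_eq_div, lt_div_iff₀ hm'] at hm
      linarith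
  filter_upwards [h1, h2, eventually_gt_atTop 0] with m hm1 hm2 hm0
  have hm' : (0 : ℝ) < m := by exact_mod_cast hm0
  refine hm1.trans_le ?_
  have hd : 2 * ⌊(m : ℝ) * D⌋₊ ≤ m := by
    have h := Nat.floor_le (a := (m : ℝ) * D) (by positivity)
    have : (2 : ℝ) * ⌊(m : ℝ) * D⌋₊ ≤ m := by nlinarith
    exact_mod_cast this
  have hc1 : (0 : ℝ) < m.choose ⌊(m : ℝ) * q⌋₊ := by exact_mod_cast Nat.choose_pos (ht m)
  have hc2 : (0 : ℝ) < m.choose ⌊(m : ℝ) * D⌋₊ := by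
    exact_mod_cast Nat.choose_pos (by omega : ⌊(m : ℝ) * D⌋₊ ≤ m)
  refine mul_le_mul_of_nonneg_left ?_ (by positivity)
  refine Real.logb_le_logb_of_le one_lt_two (by positivity) ?_
  refine le_optMoment (exists_admissible hD (by linarith) α m) fun A g hAg => ?_
  refine le_moment_of_not_mem hρ hp0 hp1 hD hd hAg fun htA => ?_
  have := wordProb_mul_choose_le_failureProb hp0.le hp1.le htA
  linarith [hAg.failure_le]

/-! ### Limits of the rate -/

open Classical in
/-- If everything but the zero word may be skipped, then one guess suffices. -/
theorem optMoment_eq_one (hρ : 0 < ρ) (hp0 : 0 ≤ p) (hp1 : p < 1) (hD : 0 ≤ D) (hD1 : D ≤ 1)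
    {α : ℝ≥0∞} {m : ℕ} (hm : 0 < m) (h : 1 - (1 - p) ^ m ≤ failureBound α m) :
    optMoment p D ρ α m = 1 := by
  refine le_antisymm ?_ (one_le_optMoment hp0 hp1.le hρ.le hD hD1 α m)
  have hp' : 0 < 1 - p := by linarith
  have hm' : (m : ℝ) ≠ 0 := by positivity
  let A : Finset ℝ := (Finset.Icc 1 m).image fun t : ℕ => (t : ℝ) / m
  let z : Fin m → Bool := fun _ => false
  have hz : numOnes z = 0 := by simp [numOnes, z]
  have hzA : wordType z ∉ A := by
    simp only [A, wordType, hz, Finset.mem_image, Finset.mem_Icc, not_exists, not_and]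
    intro t ht e
    rw [Nat.cast_zero, zero_div, div_eq_zero_iff] at e
    have : (t : ℝ) = 0 := e.resolve_right hm'
    have : t = 0 := by exact_mod_cast this
    omega
  have hxA : ∀ x : Fin m → Bool, x ≠ z → wordType x ∈ A := by
    intro x hx
    refine Finset.mem_image.2 ⟨numOnes x, Finset.mem_Icc.2 ⟨?_, numOnes_le x⟩, rfl⟩
    by_contra h0
    apply hx
    have h1 : numOnes x = 0 := by omega
    rw [numOnes, Finset.card_eq_zero, Finset.filter_eq_empty_iff] at h1
    funext i
    simpa [z] using h1 (Finset.mem_univ i)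
  have hsum : ∀ f : (Fin m → Bool) → ℝ,
      (∑ x : Fin m → Bool, if wordType x ∈ A then 0 else f x) = f z := by
    intro f
    rw [Finset.sum_eq_single z (fun x _ hx => if_pos (hxA x hx))
      (fun h => absurd (Finset.mem_univ z) h), if_neg hzA]
  have hF : 1 - failureProb p m A = (1 - p) ^ m := by
    rw [one_sub_failureProb, hsum, wordProb_eq, hz]
    simp
  have hpm : 0 < (1 - p) ^ m := by positivity
  have hit : Hits D z z := by
    rw [Hits, hammingDist_self]
    push_cast
    positivity
  have adm : Admissible p D α A fun _ => z := by
    refine ⟨by linarith, by linarith, fun x hx => ⟨0, ?_⟩⟩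
    by_cases hxz : x = z
    · rw [hxz]; exact hit
    · exact absurd (hxA x hxz) hx
  refine (optMoment_le_moment hp0 hp1.le hρ.le adm).trans (le_of_eq ?_)
  have hG : guesswork D (fun _ => z) z = 1 := by
    have : sInf {k : ℕ | Hits D z ((fun _ => z) k)} = 0 :=
      Nat.sInf_eq_zero.2 (Or.inl hit)
    rw [guesswork, this]
  rw [moment, hsum, hF, hG, wordProb_eq, hz]
  simp [hpm.ne']

theorem tendsto_optRate_zero (hρ : 0 < ρ) (hp0 : 0 ≤ p) (hp1 : p < 1) (hD : 0 ≤ D) (hD1 : D ≤ 1)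
    {α : ℝ≥0∞} (h : ∀ m, 1 - (1 - p) ^ m ≤ failureBound α m) :
    Tendsto (fun m : ℕ => optRate p D ρ α m) atTop (𝓝 0) := by
  refine tendsto_const_nhds.congr' ?_
  filter_upwards [eventually_gt_atTop 0] with m hm
  rw [optRate, optMoment_eq_one hρ hp0 hp1 hD hD1 hm (h m), Real.logb_one, mul_zero]

theorem tendsto_optRate (hρ : 0 < ρ) (hp0 : 0 < p) (hp1 : p < 1) (hD : 0 ≤ D) (hD1 : D ≤ 1)
    {α : ℝ≥0∞} {φ : ℝ}
    (hup : ∀ᶠ m : ℕ in atTop, optMoment p D ρ α m ≤ 4 * (2 * ((m : ℝ) + 1) ^ 3) ^ ρ *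
      ((2 : ℝ) ^ ((m : ℝ) * φ) / (m.choose ⌊(m : ℝ) * D⌋₊ : ℝ) ^ ρ))
    (hlow : ∀ c < φ - ρ * entropy D, ∀ᶠ m : ℕ in atTop, c < optRate p D ρ α m) :
    Tendsto (fun m : ℕ => optRate p D ρ α m) atTop (𝓝 (φ - ρ * entropy D)) := by
  refine tendsto_order.2 ⟨hlow, fun c hc => ?_⟩
  filter_upwards [hup, (tendsto_upper_rate ρ φ hD hD1).eventually_lt_const hc] with m h1 h2
  refine lt_of_le_of_lt ?_ h2
  have := one_le_optMoment hp0.le hp1.le hρ.le hD hD1 α m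
  exact mul_le_mul_of_nonneg_left
    (Real.logb_le_logb_of_le one_lt_two (by linarith) h1) (by positivity)

theorem binKLExt_ne_top (hp0 : 0 < p) (hp1 : p < 1) (s : ℝ) : binKLExt s p ≠ ⊤ := by
  rw [binKLExt, if_neg (by rintro (h | h) <;> linarith [h.1])]
  exact ENNReal.ofReal_ne_top

theorem toReal_binKLExt (hp0 : 0 < p) (hp1 : p < 1) {s : ℝ} (hs0 : 0 ≤ s) (hs1 : s ≤ 1) :
    (binKLExt s p).toReal = binKL s p := by
  rw [binKLExt, if_neg (by rintro (h | h) <;> linarith [h.1]),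
    ENNReal.toReal_ofReal (binKL_nonneg hp0 hp1 hs0 hs1)]

/-- At `r = s` the divergence equals `α` and the class may be skippable. Moving `r` slightly towards
`p` makes the divergence strictly smaller, and by continuity the exponent stays above `c`. -/
theorem eventually_lt_optRate_binKLExt (hρ : 0 < ρ) (hp0 : 0 < p) (hp1 : p < 1) (hD : 0 ≤ D)
    (hD2 : D ≤ 1 / 2) {s r : ℝ} (hps : p < s) (hs1 : s ≤ 1) (hpr : p ≤ r) (hrs : r ≤ s) {c : ℝ}
    (hc : c < ρ * entropy r - binKL r p - ρ * entropy D) :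
    ∀ᶠ m : ℕ in atTop, c < optRate p D ρ (binKLExt s p) m := by
  have cont : Continuous fun l : ℝ => ρ * entropy (r + l * (p - r)) -
      binKL (r + l * (p - r)) p - ρ * entropy D := by
    have h1 : Continuous fun l : ℝ => entropy (r + l * (p - r)) :=
      continuous_entropy.comp (by fun_prop)
    have h2 : Continuous fun l : ℝ => binKL (r + l * (p - r)) p :=
      (continuous_binKL_left hp0 hp1).comp (by fun_prop)
    fun_prop
  have lim := (cont.tendsto 0).mono_left (nhdsWithin_le_nhds (s := Set.Ioi 0))
  simp only [zero_mul, add_zero] at lim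
  obtain ⟨l, hl, hl0, hl1⟩ := ((lim.eventually_const_lt hc).and
    (Ioo_mem_nhdsGT (zero_lt_one (α := ℝ)))).exists
  set q := r + l * (p - r) with hq
  have hpq : p ≤ q := by nlinarith
  have hqs : q < s := by
    rcases hpr.eq_or_lt with h | h
    · rw [hq, ← h]; linarith
    · nlinarith
  refine eventually_lt_optRate hρ hp0 hp1 hD hD2 (by linarith) (by linarith) (fun _ => ?_) hl
  rw [toReal_binKLExt hp0 hp1 (by linarith) hs1]
  exact binKL_lt_binKL hp0 hp1 hpq hqs hs1

theorem entropy_le_entropy (hD : 0 ≤ D) (hDp : D ≤ p) (hp : p ≤ 1 / 2) :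
    entropy D ≤ entropy p :=
  div_le_div_of_nonneg_right (Real.binEntropy_strictMonoOn.monotoneOn ⟨hD, by linarith⟩
    ⟨by linarith, by linarith⟩ hDp) (Real.log_pos one_lt_two).le

theorem logit_sStar (hρ : 0 < ρ) (hp0 : 0 < p) (hp1 : p < 1) :
    (1 + ρ) * (Real.log (sStar ρ p) - Real.log (1 - sStar ρ p)) =
      Real.log p - Real.log (1 - p) := by
  rw [log_sStar ρ hp0 hp1, log_one_sub_sStar ρ hp0 hp1]
  have : 1 + ρ ≠ 0 := by linarith
  field_simp
  ring

/-- Skipping nothing is allowed for every `α`, and at `s*` the slope in the tilting inequality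
vanishes, so the inequality holds for all weights. -/
theorem optMoment_le_of_sStar (hρ : 0 < ρ) (hp0 : 0 < p) (hD : 0 ≤ D) (hDp : D ≤ p)
    (hp : p ≤ 1 / 2) (α : ℝ≥0∞) {m : ℕ} (hm : 0 < m) :
    optMoment p D ρ α m ≤ 4 * (2 * ((m : ℝ) + 1) ^ 3) ^ ρ *
      ((2 : ℝ) ^ ((m : ℝ) * (ρ * entropy (sStar ρ p) - binKL (sStar ρ p) p)) /
        (m.choose ⌊(m : ℝ) * D⌋₊ : ℝ) ^ ρ) := by
  have hp1 : p < 1 := by linarith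
  refine optMoment_le (A := ∅) hρ hp0 hp1 hD (by linarith) (sStar_pos ρ hp0 hp1)
    (sStar_lt_one ρ hp0 hp1) ?_ hm ?_ ?_ ?_
  · refine le_trans ?_ (exponent_mono hρ hp0 hp1 (le_sStar hρ hp0 hp) le_rfl)
    exact mul_le_mul_of_nonneg_left (entropy_le_entropy hD hDp hp) hρ.le
  · intro x _
    rw [logit_sStar hρ hp0 hp1, sub_self, mul_zero]
  · rw [failureProb_empty]; exact failureBound_nonneg α m
  · rw [failureProb_empty]; norm_num

theorem eventually_optMoment_le (hρ : 0 < ρ) (hp0 : 0 < p) (hD : 0 ≤ D) (hDp : D ≤ p)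
    (hp : p ≤ 1 / 2) {s : ℝ} (hps : p < s) (hs : s ≤ sStar ρ p) :
    ∀ᶠ m : ℕ in atTop, optMoment p D ρ (binKLExt s p) m ≤ 4 * (2 * ((m : ℝ) + 1) ^ 3) ^ ρ *
      ((2 : ℝ) ^ ((m : ℝ) * (ρ * entropy s - binKL s p)) /
        (m.choose ⌊(m : ℝ) * D⌋₊ : ℝ) ^ ρ) := by
  classical
  have hp1 : p < 1 := by linarith
  have hs0 : 0 < s := by linarith
  have hs1 : s < 1 := hs.trans_lt (sStar_lt_one ρ hp0 hp1)
  have hpos := binKL_pos hp0 hp1 hs0.le hs1.le hps.ne'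
  -- Makes the failure bound `2^(-D(s‖p) m)` at most `1/2`.
  have hlarge : ∀ᶠ m : ℕ in atTop, 1 ≤ binKL s p * (m : ℝ) :=
    (tendsto_natCast_atTop_atTop.const_mul_atTop hpos).eventually_ge_atTop 1
  filter_upwards [hlarge, eventually_gt_atTop 0] with m hm1 hm
  have hm' : (m : ℝ) ≠ 0 := by positivity
  let A : Finset ℝ :=
    ((Finset.range (m + 1)).filter fun t : ℕ => s * m ≤ t).image fun t : ℕ => (t : ℝ) / m
  have hA : ∀ x : Fin m → Bool, wordType x ∈ A ↔ s * m ≤ numOnes x := by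
    intro x
    simp only [A, wordType, Finset.mem_image, Finset.mem_filter, Finset.mem_range]
    constructor
    · rintro ⟨t, ⟨_, ht⟩, e⟩
      rw [div_left_inj' hm'] at e
      rw [← e]
      exact ht
    · intro h
      exact ⟨numOnes x, ⟨Nat.lt_succ_of_le (numOnes_le x), h⟩, rfl⟩
  have hF := failureProb_le hp0 hp1 hs0 hs1 hps.le fun x h => (hA x).1 h
  refine optMoment_le (A := A) hρ hp0 hp1 hD (by linarith) hs0 hs1 ?_ hm ?_ ?_ ?_
  · exact (mul_le_mul_of_nonneg_left (entropy_le_entropy hD hDp hp) hρ.le).trans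
      (exponent_mono hρ hp0 hp1 hps.le hs)
  · intro x hx
    rw [hA, not_le] at hx
    -- The kept weights lie below `s * m`, and for `s ≤ s*` the slope is nonnegative because the
    -- logit is increasing and the slope vanishes at `s*`.
    refine mul_nonpos_of_nonpos_of_nonneg (by linarith) ?_
    have h1 := Real.log_le_log hs0 hs
    have h2 := Real.log_le_log (sub_pos.2 (sStar_lt_one ρ hp0 hp1)) (sub_le_sub_left hs 1)
    rw [← logit_sStar hρ hp0 hp1]
    nlinarith
  · rwa [failureBound, if_neg (binKLExt_ne_top hp0 hp1 s), toReal_binKLExt hp0 hp1 hs0.le hs1.le]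
  · refine hF.trans ?_
    calc (2 : ℝ) ^ (-(binKL s p * m)) ≤ 2 ^ (-1 : ℝ) :=
          Real.rpow_le_rpow_of_exponent_le one_le_two (by linarith)
      _ = 1 / 2 := by rw [Real.rpow_neg_one]; norm_num

end

end Guesswork

/-! ### The main theorem -/

theorem theorem2 (ρ p D : ℝ) (hρ : 0 < ρ) (hD : 0 ≤ D) (hDp : D ≤ p) (hp : p ≤ 1 / 2) :
    (∀ s : ℝ, Guesswork.sStar ρ p ≤ s → s ≤ 1 →
      ∃ L : ℝ,
        Tendsto (fun m : ℕ => Guesswork.optRate p D ρ (Guesswork.binKLExt s p) m) atTop (𝓝 L) ∧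
        L ≤ ρ * (Guesswork.renyiEntropy (1 / (1 + ρ)) p - Guesswork.entropy D)) ∧
    (∀ s : ℝ, p < s → s ≤ Guesswork.sStar ρ p →
      ∃ L : ℝ,
        Tendsto (fun m : ℕ => Guesswork.optRate p D ρ (Guesswork.binKLExt s p) m) atTop (𝓝 L) ∧
        L ≤ ρ * (Guesswork.entropy s - Guesswork.entropy D) - Guesswork.binKL s p) ∧
    Tendsto (fun m : ℕ => Guesswork.optRate p D ρ ⊤ m) atTop
      (𝓝 (ρ * (Guesswork.renyiEntropy (1 / (1 + ρ)) p - Guesswork.entropy D))) := by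
  open Guesswork in
  have hp1 : p < 1 := by linarith
  -- For `p = 0` only the zero word has positive probability, so one guess is enough; then `D = 0`
  -- and both the rate and the bound are `0`.
  rcases (hD.trans hDp).eq_or_lt with rfl | hp0
  · obtain rfl : D = 0 := le_antisymm hDp hD
    have triv : ∀ α : ℝ≥0∞, Tendsto (fun m : ℕ => optRate 0 0 ρ α m) atTop (𝓝 0) := fun α =>
      tendsto_optRate_zero hρ le_rfl hp1 le_rfl zero_le_one fun m => by
        simpa using failureBound_nonneg α m
    have hexp : 1 / (1 + ρ) ≠ 0 := by positivity
    have hz : ρ * (renyiEntropy (1 / (1 + ρ)) 0 - entropy 0) = 0 := by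
      simp only [renyiEntropy, entropy, Real.zero_rpow hexp]
      simp
    have hs : sStar ρ 0 = 0 := by rw [sStar, Real.zero_rpow hexp, zero_div]
    refine ⟨fun s _ _ => ⟨0, triv _, hz.ge⟩, fun s h1 h2 => ?_, ?_⟩
    · rw [hs] at h2
      exact absurd h1 (not_lt.2 h2)
    · rw [hz]; exact triv ⊤
  have hD1 : D ≤ 1 := by linarith
  have hD2 : D ≤ 1 / 2 := by linarith
  have hps := le_sStar hρ hp0 hp
  have star := exponent_sStar hρ hp0 hp1
  have e : ρ * (renyiEntropy (1 / (1 + ρ)) p - entropy D) =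
      ρ * entropy (sStar ρ p) - binKL (sStar ρ p) p - ρ * entropy D := by rw [star]; ring
  have hup : ∀ α : ℝ≥0∞, ∀ᶠ m : ℕ in atTop, _ := fun α =>
    (eventually_gt_atTop 0).mono fun m hm =>
      optMoment_le_of_sStar hρ hp0 hD hDp hp α hm
  refine ⟨fun s hs hs1 => ?_, fun s h1 h2 => ?_, ?_⟩
  -- If `s = p`, then also `s* = p` and `α = 0`: everything but the zero word may be skipped, and
  -- the rate `0` lies below the bound.
  · rcases (hps.trans hs).eq_or_lt with rfl | hlt
    · refine ⟨0, tendsto_optRate_zero hρ hp0.le hp1 hD hD1 fun m => ?_, ?_⟩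
      · rw [failureBound, if_neg (binKLExt_ne_top hp0 hp1 p), toReal_binKLExt hp0 hp1 hp0.le hp1.le,
          binKL_self hp0 hp1, zero_mul, neg_zero, Real.rpow_zero]
        have : 0 ≤ (1 - p) ^ m := pow_nonneg (by linarith) m
        linarith
      · have h1 := exponent_mono hρ hp0 hp1 hps le_rfl
        have h2 := mul_le_mul_of_nonneg_left (entropy_le_entropy hD hDp hp) hρ.le
        rw [e]
        linarith
    · exact ⟨_, tendsto_optRate hρ hp0 hp1 hD hD1 (hup _) fun c hc =>
        eventually_lt_optRate_binKLExt hρ hp0 hp1 hD hD2 hlt hs1 hps hs hc, e.ge⟩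
  · have hs1 := (h2.trans_lt (sStar_lt_one ρ hp0 hp1)).le
    refine ⟨_, tendsto_optRate hρ hp0 hp1 hD hD1
      (eventually_optMoment_le hρ hp0 hD hDp hp h1 h2) fun c hc =>
        eventually_lt_optRate_binKLExt hρ hp0 hp1 hD hD2 h1 hs1 h1.le le_rfl hc, ?_⟩
    linarith
  · rw [e]
    exact tendsto_optRate hρ hp0 hp1 hD hD1 (hup _) fun c hc =>
      eventually_lt_optRate hρ hp0 hp1 hD hD2 (sStar_pos ρ hp0 hp1).le
        (sStar_lt_one ρ hp0 hp1).le (fun h => absurd rfl h) hc
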